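/- Let $d_x,d_y$ be non-negative integers, let $A\in\mathbb{Q}[x,y]$ be a nonzero polynomial with $\deg_xA<d_x$ and $\deg_yA<d_y$, and let $B(x,y)=\sum_{i\le d_x,\,j\le d_y}b_{i,j}x^iy^j$, where the $b_{i,j}$ are indeterminates. Put $k=\mathbb{Q}((b_{i,j}))$ and $\mathbb{K}=k(t)$. Algorithm AlgebraicDiagonal, on input $A/B$, does the following. 1. Write $\frac1y\,\frac{A(t/y,y)}{B(t/y,y)}=\frac{P}{Q}$ with coprime $P,Q\in k[t,y]$. 2. (AlgebraicResidues) Take a squarefree decomposition $Q=Q_1Q_2^2\cdots Q_m^m$ in $\mathbb{K}[y]$, with the $Q_i$ squarefree and pairwise coprime and $\deg_y Q_m>0$. For each $i$ with $\deg_yQ_i>0$, set $U_i=Q/Q_i^i$ and $V_i(y,u)=(Q_i(y+u)-Q_i(y))/u$, write the coefficient of $u^{i-1}$ in the power series expansion at $u=0$ of $P(y+u)/(U_i(y+u)V_i(y,u)^i)$ as $A_i/B_i$ with coprime $A_i,B_i\in\mathbb{K}[y]$, and set $R_i(z)=\operatorname{Resultant}_y(A_i-zB_i,Q_i)$; for the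 other $i$ set $R_i=1$. Let $R=R_1\cdots R_m\in\mathbb{K}[z]$. 3. Let $c$ be the number of small branches of $Q$, i.e. of distinct roots $y$ of $Q(t,y)$ in an algebraic closure of $k((t))$ that tend to $0$ with $t$ (have positive valuation). 4. (PureComposedSum) Let $d=\deg R$, $D=\binom dc$ and $\operatorname{rec}(f)(u)=u^{\deg f}f(1/u)$. Compute $N=\operatorname{rec}(R')/\operatorname{rec}(R)\bmod u^{D+1}$; $S=N\odot\exp(u)\bmod u^{D+1}$, where $\odot$ is the coefficientwise product; $F=\exp\bigl(\sum_{n=1}^c(-1)^{n-1}\frac{S(nu)}{n}v^n\bigr)\bmod(u^{D+1},v^{c+1})$; $M=([v^c]F)\odot\sum_n n!\,u^n\bmod u^{D+1}$; and $\Psi=\operatorname{rec}\bigl(\exp\bigl(\int\frac{D-M}{u}\,du\bigr)\bmod u^{D+1}\bigr)$. 5. Return the numerator $\Phi(t,\Delta)\in k[t,\Delta]$ of $\Psi(\Delta)\in\mathbb{K}[\Delta]$, written in lowest terms with a denominator in $k[t]$. Then the algorithm has an output, and every polynomial $\Phi$ that it can output (for any admissible choice of the normalizations in its steps) is irreducible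 over $\mathbb{K}=\mathbb{Q}((b_{i,j});t)$ as a polynomial in $\Delta$, has degree $\binom{d_x+d_y}{d_x}$ in $\Delta$, and satisfies $\Phi(t,\operatorname{Diag}(A/B))=0$. Here $\operatorname{Diag}(A/B)=\sum_nf_{n,n}t^n\in k[[t]]$ is the diagonal of the expansion $A/B=\sum_{i,j\ge 0}f_{i,j}x^iy^j\in k[[x,y]]$. Consequently the minimal polynomial of $\operatorname{Diag}(A/B)$ over $\mathbb{K}$ has degree $\binom{d_x+d_y}{d_x}\ge2^{\min(d_x,d_y)}$, which is exponential in the degree of the input. -/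

import Mathlib

open Polynomial

noncomputable section

namespace AlgDiag

/-! ### Polynomials cancelling residues -/

section Residues

variable {F : Type*} [Field F]

/-- `Q = Q₁ Q₂² ⋯ Qₘᵐ` is a squarefree decomposition of `Q`: the `Qᵢ` (`1 ≤ i ≤ m`) are squarefree
and pairwise coprime and `Qₘ` is not constant. -/
structure IsSquarefreeDecomposition (Q : F[X]) (m : ℕ) (q : ℕ → F[X]) : Prop where
  one_le : 1 ≤ m
  prod_eq : Q = ∏ i ∈ Finset.Icc 1 m, q i ^ i
  squarefree : ∀ i ∈ Finset.Icc 1 m, Squarefree (q i)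
  coprime : ∀ i ∈ Finset.Icc 1 m, ∀ j ∈ Finset.Icc 1 m, i ≠ j → IsCoprime (q i) (q j)
  natDegree_pos : 0 < (q m).natDegree

/-- `p(y + t)`, as a polynomial in `t` with coefficients in the field `F(y)`. -/
def shift (p : F[X]) : (RatFunc F)[X] :=
  taylor RatFunc.X (p.map (algebraMap F (RatFunc F)))

/-- `(q(y + t) - q(y)) / t`, as a polynomial in `t` with coefficients in the field `F(y)`. -/
def diffQuot (q : F[X]) : (RatFunc F)[X] :=
  (shift q - C (algebraMap F[X] (RatFunc F) q)).divX

/-- For a factor `q` of multiplicity `i` in `Q`: the expansion at `t = 0`, in `F(y)⟦t⟧`, of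
`P(y + t) / (U(y + t) V(y, t)ⁱ)`, where `U = Q / qⁱ` and `V(y, t) = (q(y + t) - q(y)) / t`. -/
def residueSeries (P Q q : F[X]) (i : ℕ) : PowerSeries (RatFunc F) :=
  (shift P : PowerSeries (RatFunc F)) *
    ((shift (Q / q ^ i) * diffQuot q ^ i : (RatFunc F)[X]) : PowerSeries (RatFunc F))⁻¹

/-- `Resultant_y(a(y) - z b(y), q(y))`, a polynomial in `z`. -/
def residueResultant (a b q : F[X]) : F[X] :=
  resultant (a.map C - C X * b.map C : F[X][X]) (q.map C)

/-- `r` is the factor produced for the factor `q` of multiplicity `i` in `Q`. -/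
def IsResidueFactor (P Q q : F[X]) (i : ℕ) (r : F[X]) : Prop :=
  (q.natDegree = 0 ∧ r = 1) ∨
  (q.natDegree ≠ 0 ∧ ∃ a b : F[X], b ≠ 0 ∧ IsCoprime a b ∧
    PowerSeries.coeff (i - 1) (residueSeries P Q q i) =
      algebraMap F[X] (RatFunc F) a / algebraMap F[X] (RatFunc F) b ∧
    r = residueResultant a b q)

/-- `R` is a possible output of the algorithm **AlgebraicResidues** on `P / Q`. It depends on the
choice of a squarefree decomposition of `Q` and on the scaling of the fractions `a / b`. -/
def IsAlgebraicResidues (P Q R : F[X]) : Prop :=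
  ∃ (m : ℕ) (q r : ℕ → F[X]), IsSquarefreeDecomposition Q m q ∧
    (∀ i ∈ Finset.Icc 1 m, IsResidueFactor P Q (q i) i (r i)) ∧
    R = ∏ i ∈ Finset.Icc 1 m, r i

end Residues

/-! ### Polynomials cancelling sums of roots -/

section Sums

variable {F : Type*} [Field F] [CharZero F]

/-- The truncation `f mod yⁿ`, as a power series. -/
def modPow (n : ℕ) (f : PowerSeries F) : PowerSeries F :=
  (PowerSeries.trunc n f : F[X])

/-- The Hadamard product of two power series. -/
def hadamard (f g : PowerSeries F) : PowerSeries F :=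
  PowerSeries.mk fun n => PowerSeries.coeff n f * PowerSeries.coeff n g

/-- The series `exp(∑_{n=1}^c (-1)^{n-1} S(n y) zⁿ / n)` of `F⟦y⟧⟦z⟧`; the coefficients are series
in `y`, the outer variable is `z`. -/
def expSum (S : PowerSeries F) (c : ℕ) : PowerSeries (PowerSeries F) :=
  (PowerSeries.exp ℚ).subst
    (∑ n ∈ Finset.Icc 1 c, PowerSeries.monomial n
      (((-1 : F) ^ (n - 1) / (n : F)) • PowerSeries.rescale (n : F) S) :
        PowerSeries (PowerSeries F))

/-- The antiderivative without constant term of `f / y`, for `f` without constant term. -/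
def integralDivX (f : PowerSeries F) : PowerSeries F :=
  PowerSeries.mk fun n => PowerSeries.coeff n f / (n : F)

/-- The algorithm **PureComposedSum**: the polynomial whose roots are the sums of `c` roots of `P`,
computed from the generating series of Newton sums. `Polynomial.reverse` is the reciprocal
`y^{deg P} P(1/y)`. -/
def pureComposedSum (P : F[X]) (c : ℕ) : F[X] :=
  let D : ℕ := P.natDegree.choose c
  let N : PowerSeries F := modPow (D + 1)
    (((derivative P).reverse : PowerSeries F) * (P.reverse : PowerSeries F)⁻¹)
  let S : PowerSeries F := modPow (D + 1) (hadamard N (PowerSeries.exp F))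
  let E : PowerSeries F := modPow (D + 1) ((PowerSeries.trunc (c + 1) (expSum S c)).coeff c)
  let M : PowerSeries F := modPow (D + 1)
    (hadamard E (PowerSeries.mk fun n => (n.factorial : F)))
  (PowerSeries.trunc (D + 1)
    ((PowerSeries.exp ℚ).subst (integralDivX ((D : PowerSeries F) - M)) : PowerSeries F)).reverse

end Sums

/-! ### Diagonals -/

section Diagonal

variable {k : Type*} [Field k]

/-- An algebraic function `y` over `k((t))` tends to `0` with `t`, i.e. it has positive valuation:
some power `yⁿ`, `n ≥ 1`, is `t` times an element that is integral over `k⟦t⟧`. -/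
def TendsToZero (y : AlgebraicClosure (LaurentSeries k)) : Prop :=
  ∃ n : ℕ, 0 < n ∧ ∃ z : AlgebraicClosure (LaurentSeries k), IsIntegral (PowerSeries k) z ∧
    y ^ n = algebraMap (PowerSeries k) _ PowerSeries.X * z

/-- The embedding of `k[t]` in the algebraic closure of `k((t))`. -/
def polyToBranches (k : Type*) [Field k] : k[X] →+* AlgebraicClosure (LaurentSeries k) :=
  (algebraMap (PowerSeries k) (AlgebraicClosure (LaurentSeries k))).comp
    coeToPowerSeries.ringHom

/-- The number of small branches of `Q(t, y)` (`t` is the inner variable, `y` the outer one): the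
number of distinct roots `y(t)` that tend to `0` with `t`. -/
def numSmallBranches (Q : k[X][X]) : ℕ :=
  {y : AlgebraicClosure (LaurentSeries k) | (Q.map (polyToBranches k)).IsRoot y ∧
    TendsToZero y}.ncard

/-- `A(t / y, y)` in the field `k(t, y)`, the fraction field of `k[t][y]`. -/
def substDiag (A : MvPolynomial (Fin 2) k) : FractionRing k[X][X] :=
  MvPolynomial.aeval
    ![algebraMap k[X][X] (FractionRing k[X][X]) (C X) / algebraMap k[X][X] (FractionRing k[X][X]) X,
      algebraMap k[X][X] (FractionRing k[X][X]) X] A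

/-- `P / Q` is a reduced form of `(1 / y) (A / B)(t / y, y)`. -/
def IsReducedForm (A B : MvPolynomial (Fin 2) k) (P Q : k[X][X]) : Prop :=
  Q ≠ 0 ∧ IsRelPrime P Q ∧
    1 / algebraMap k[X][X] (FractionRing k[X][X]) X * (substDiag A / substDiag B) =
      algebraMap k[X][X] (FractionRing k[X][X]) P / algebraMap k[X][X] (FractionRing k[X][X]) Q

/-- View a polynomial of `k[t][y]` as a polynomial in `y` over the field `k(t)`. -/
def overRatFunc (P : k[X][X]) : (RatFunc k)[X] :=
  P.map (algebraMap k[X] (RatFunc k))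

/-- `Φ ∈ k[t][z]` is a numerator of `Ψ ∈ k(t)[z]`: `Ψ = Φ / e` in lowest terms, `e ∈ k[t]`. -/
def IsNumer (Ψ : (RatFunc k)[X]) (Φ : k[X][X]) : Prop :=
  ∃ e : k[X], e ≠ 0 ∧ IsRelPrime Φ (C e) ∧
    overRatFunc Φ = C (algebraMap k[X] (RatFunc k) e) * Ψ

/-- `Φ ∈ k[t][Δ]` is a possible output of the algorithm **AlgebraicDiagonal** on `A / B`. -/
def IsAlgebraicDiagonal [CharZero k] (A B : MvPolynomial (Fin 2) k) (Φ : k[X][X]) : Prop :=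
  ∃ (P Q : k[X][X]) (R : (RatFunc k)[X]), IsReducedForm A B P Q ∧
    IsAlgebraicResidues (overRatFunc P) (overRatFunc Q) R ∧
    IsNumer (pureComposedSum R (numSmallBranches Q)) Φ

/-- The diagonal `∑ₙ f_{n,n} tⁿ` of a bivariate power series `∑ f_{i,j} xⁱ yʲ`. -/
def diag (f : MvPowerSeries (Fin 2) k) : PowerSeries k :=
  PowerSeries.mk fun n => MvPowerSeries.coeff (Finsupp.single 0 n + Finsupp.single 1 n) f

/-- The diagonal of the power series expansion of `A / B` (where `B(0,0) ≠ 0`). -/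
def ratDiag (A B : MvPolynomial (Fin 2) k) : PowerSeries k :=
  diag ((A : MvPowerSeries (Fin 2) k) * (B : MvPowerSeries (Fin 2) k)⁻¹)

end Diagonal

section MinimalPolynomial

open scoped RatFunc

/-- The minimal polynomial over `k(t)` of a power series in `k⟦t⟧`, viewed in `k((t))`
(it is `0` if the series is not algebraic). -/
def seriesMinpoly {k : Type*} [Field k] (f : PowerSeries k) : (RatFunc k)[X] :=
  minpoly (RatFunc k) (algebraMap (PowerSeries k) (LaurentSeries k) f)

end MinimalPolynomial

/-! ### The generic denominator -/

/-- The field `ℚ(b_{i,j})` in the indeterminates `b_{i,j}`, `0 ≤ i ≤ dx`, `0 ≤ j ≤ dy`. -/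
abbrev GenericField (dx dy : ℕ) : Type :=
  FractionRing (MvPolynomial (Fin (dx + 1) × Fin (dy + 1)) ℚ)

/-- `B(x, y) = ∑_{i ≤ dx, j ≤ dy} b_{i,j} xⁱ yʲ`. -/
def genericB (dx dy : ℕ) : MvPolynomial (Fin 2) (GenericField dx dy) :=
  ∑ i : Fin (dx + 1), ∑ j : Fin (dy + 1),
    MvPolynomial.C (algebraMap (MvPolynomial (Fin (dx + 1) × Fin (dy + 1)) ℚ) (GenericField dx dy)
        (MvPolynomial.X (i, j))) *
      MvPolynomial.X 0 ^ (i : ℕ) * MvPolynomial.X 1 ^ (j : ℕ)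

/-- `A ∈ ℚ[x, y]` viewed over `ℚ(b_{i,j})`. -/
def extendA (dx dy : ℕ) (A : MvPolynomial (Fin 2) ℚ) : MvPolynomial (Fin 2) (GenericField dx dy) :=
  MvPolynomial.map (algebraMap ℚ (GenericField dx dy)) A

end AlgDiag

end

/-!
Let `P / Q` be a reduced form of `(1 / y) (A / B)(t / y, y)`. The diagonal of `A / B` is the
coefficient of `1 / y` in the expansion of `P / Q`, that is the sum of the residues of `P / Q` at
the small branches of `Q`; there are `dx` of them, because the coefficient of `y ^ dx` is the first
one of `Q` that does not vanish at `t = 0`.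

As the coefficients of `B` are indeterminates, `k(t)` embeds in a field over which `Q` becomes a
multiple of `∏ (y - Yᵢ)` with independent indeterminates `Yᵢ`, so that all permutations of the
roots of `Q` are realized by endomorphisms over `k(t)`. It follows that the residues are pairwise
distinct and that the sums of `dx` of them are pairwise distinct as well. These sums are permuted
transitively, hence the polynomial with these roots is irreducible.
-/

noncomputable section

namespace AlgDiag

section SplitsWithRoots

variable {F E ι : Type*} [CommRing F] [Field E] [Fintype ι]

/-- Over the extension `θ : F →+* E`, the polynomial `P` has leading coefficient `a ≠ 0` and roots
`r i`, listed with multiplicity. -/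
structure SplitsWithRoots (θ : F →+* E) (P : F[X]) (a : E) (r : ι → E) : Prop where
  leadingCoeff_ne_zero : a ≠ 0
  map_eq : P.map θ = C a * ∏ i, (X - C (r i))

namespace SplitsWithRoots

variable {θ : F →+* E} {P : F[X]} {a : E} {r : ι → E}

lemma natDegree_eq {F : Type*} [Field F] {θ : F →+* E} {P : F[X]}
    (h : SplitsWithRoots θ P a r) : P.natDegree = Fintype.card ι := by
  rw [← natDegree_map θ, h.map_eq, natDegree_C_mul h.leadingCoeff_ne_zero,
    natDegree_finsetProd_X_sub_C_eq_card, Finset.card_univ]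

lemma ne_zero (h : SplitsWithRoots θ P a r) : P ≠ 0 := by
  rintro rfl
  have hprod : C a * ∏ i, (X - C (r i)) ≠ 0 := mul_ne_zero (C_ne_zero.2 h.leadingCoeff_ne_zero)
    (Finset.prod_ne_zero_iff.2 fun i _ => X_sub_C_ne_zero (r i))
  exact hprod (by rw [← h.map_eq, Polynomial.map_zero])

lemma isRoot_iff (h : SplitsWithRoots θ P a r) {y : E} :
    (P.map θ).IsRoot y ↔ y ∈ Set.range r := by
  rw [h.map_eq, IsRoot, eval_C_mul, mul_eq_zero, or_iff_right h.leadingCoeff_ne_zero, ← IsRoot,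
    isRoot_prod]
  simp only [Finset.mem_univ, true_and, root_X_sub_C, Set.mem_range]

lemma isRoot (h : SplitsWithRoots θ P a r) (i : ι) : (P.map θ).IsRoot (r i) :=
  h.isRoot_iff.2 ⟨i, rfl⟩

lemma eval_derivative [DecidableEq ι] (h : SplitsWithRoots θ P a r) (i : ι) :
    (derivative (P.map θ)).eval (r i) = a * ∏ j ∈ Finset.univ.erase i, (r i - r j) := by
  rw [h.map_eq, derivative_C_mul, eval_mul, eval_C,
    ← Finset.mul_prod_erase _ _ (Finset.mem_univ i), derivative_mul, eval_add, eval_mul, eval_mul,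
    derivative_X_sub_C, eval_one, one_mul, eval_sub, eval_X, eval_C, sub_self, zero_mul, add_zero,
    eval_prod]
  simp only [eval_sub, eval_X, eval_C]

lemma eval_derivative_ne_zero (h : SplitsWithRoots θ P a r) (hr : Function.Injective r) (i : ι) :
    (derivative (P.map θ)).eval (r i) ≠ 0 := by
  classical
  rw [h.eval_derivative]
  exact mul_ne_zero h.leadingCoeff_ne_zero <| Finset.prod_ne_zero_iff.2 fun j hj =>
    sub_ne_zero.2 (hr.ne (Finset.ne_of_mem_erase hj).symm)

lemma C_mul (h : SplitsWithRoots θ P a r) {b : F} (hb : θ b ≠ 0) :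
    SplitsWithRoots θ (C b * P) (θ b * a) r where
  leadingCoeff_ne_zero := mul_ne_zero hb h.leadingCoeff_ne_zero
  map_eq := by rw [Polynomial.map_mul, h.map_eq, map_C, Polynomial.C_mul, mul_assoc]

end SplitsWithRoots

end SplitsWithRoots

section Newton

open Finset

lemma succ_mul_sum_powersetCard_prod {T ι : Type*} [CommRing T] [Fintype ι] (e : ι → T) (n : ℕ) :
    ((n + 1 : ℕ) : T) * ∑ I ∈ powersetCard (n + 1) univ, ∏ i ∈ I, e i =
      ∑ p ∈ antidiagonal n, ((-1) ^ p.1 * ∑ i, e i ^ (p.1 + 1)) *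
        ∑ I ∈ powersetCard p.2 univ, ∏ i ∈ I, e i := by
  have newton := congrArg (MvPolynomial.aeval (R := ℤ) e)
    (MvPolynomial.mul_esymm_eq_sum ι ℤ (n + 1))
  rw [sum_filter, Nat.sum_antidiagonal_succ', if_neg (lt_irrefl _), zero_add] at newton
  simp only [map_mul, map_natCast, map_pow, map_neg, map_one, map_sum, MvPolynomial.esymm,
    MvPolynomial.psum, MvPolynomial.aeval_X, map_prod, apply_ite, map_zero] at newton
  rw [newton, ← Nat.sum_antidiagonal_swap, mul_sum]
  refine sum_congr rfl fun p hp => ?_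
  obtain rfl : p.1 + p.2 = n := HasAntidiagonal.mem_antidiagonal.1 hp
  simp only [Prod.fst_swap, Prod.snd_swap]
  rw [if_pos (by omega)]
  have hsign : ((-1 : T) ^ p.2) ^ 2 = 1 := by rw [← pow_mul, pow_mul', neg_one_sq, one_pow]
  linear_combination ((-1) ^ p.1 * (∑ i, e i ^ (p.1 + 1)) *
    ∑ I ∈ powersetCard p.2 univ, ∏ i ∈ I, e i) * hsign

variable {S : Type*} [CommRing S] [Algebra ℚ S]

lemma exp_subst_eq {g : PowerSeries S} (hg : PowerSeries.HasSubst g) :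
    (PowerSeries.exp ℚ).subst g = (PowerSeries.exp S).subst g := by
  ext n
  rw [PowerSeries.coeff_subst' hg, PowerSeries.coeff_subst' hg]
  refine finsum_congr fun d => ?_
  simp [PowerSeries.coeff_exp, Algebra.smul_def]

lemma coeff_zero_exp_subst {g : PowerSeries S} (hg : PowerSeries.constantCoeff g = 0) :
    PowerSeries.coeff 0 ((PowerSeries.exp ℚ).subst g) = 1 := by
  rw [PowerSeries.coeff_subst' (PowerSeries.HasSubst.of_constantCoeff_zero' hg),
    finsum_eq_single _ 0]
  · simp
  · intro d hd
    simp [hg, hd]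

lemma succ_mul_coeff_succ_exp_subst {g : PowerSeries S} (hg : PowerSeries.constantCoeff g = 0)
    (n : ℕ) :
    ((n + 1 : ℕ) : S) * PowerSeries.coeff (n + 1) ((PowerSeries.exp ℚ).subst g) =
      ∑ p ∈ antidiagonal n, (((p.1 + 1 : ℕ) : S) * PowerSeries.coeff (p.1 + 1) g) *
        PowerSeries.coeff p.2 ((PowerSeries.exp ℚ).subst g) := by
  have hs := PowerSeries.HasSubst.of_constantCoeff_zero' hg
  have chain_rule := congrArg (PowerSeries.coeff n)
    (PowerSeries.derivative_subst (f := PowerSeries.exp S) hs)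
  rw [PowerSeries.derivative_exp, PowerSeries.coeff_derivative, ← exp_subst_eq hs,
    mul_comm _ (PowerSeries.derivative S g), PowerSeries.coeff_mul] at chain_rule
  simp only [PowerSeries.coeff_derivative] at chain_rule
  push_cast
  rw [mul_comm, chain_rule]
  exact sum_congr rfl fun p _ => by ring

/-- `(exp g)' = g' exp g` is the same recursion on coefficients as Newton's identities. -/
lemma coeff_exp_subst_eq_sum_powersetCard_prod {T ι : Type*} [CommRing T] [Algebra ℚ T]
    [Fintype ι] (π : S →+* T) (e : ι → T) {g : PowerSeries S}
    (hg : PowerSeries.constantCoeff g = 0) (N : ℕ)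
    (h : ∀ n < N, ((n + 1 : ℕ) : T) * π (PowerSeries.coeff (n + 1) g) =
      (-1) ^ n * ∑ i, e i ^ (n + 1)) {n : ℕ} (hn : n ≤ N) :
    π (PowerSeries.coeff n ((PowerSeries.exp ℚ).subst g)) =
      ∑ I ∈ powersetCard n univ, ∏ i ∈ I, e i := by
  induction n using Nat.strong_induction_on with
  | _ n ih =>
  cases n with
  | zero => rw [coeff_zero_exp_subst hg, map_one, powersetCard_zero, sum_singleton, prod_empty]
  | succ n =>
    have hunit : IsUnit ((n + 1 : ℕ) : T) := by
      simpa using (Nat.cast_ne_zero (R := ℚ).2 n.succ_ne_zero).isUnit.map (algebraMap ℚ T)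
    apply hunit.mul_left_cancel
    rw [succ_mul_sum_powersetCard_prod, ← map_natCast π, ← map_mul,
      succ_mul_coeff_succ_exp_subst hg, map_sum]
    refine sum_congr rfl fun p hp => ?_
    rw [HasAntidiagonal.mem_antidiagonal] at hp
    rw [map_mul, ih p.2 (by omega) (by omega), map_mul, map_natCast, h p.1 (by omega)]

end Newton

section Reverse

variable {E ι : Type*} [Field E]

lemma reverse_X_sub_C (s : E) : (X - C s : E[X]).reverse = 1 - C s * X := by
  ext n
  rw [coeff_reverse, natDegree_X_sub_C]
  rcases n with _ | _ | n
  · simp [revAt_le]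
  · simp [revAt_le, coeff_X, coeff_one]
  · rw [revAt_eq_self_of_lt (by omega)]
    simp [coeff_X, coeff_one]

lemma reverse_prod_X_sub_C (s : Finset ι) (f : ι → E) :
    (∏ i ∈ s, (X - C (f i))).reverse = ∏ i ∈ s, (1 - C (f i) * X) := by
  classical
  induction s using Finset.induction_on with
  | empty => simpa using reverse_C (1 : E)
  | insert a s ha ih =>
    rw [Finset.prod_insert ha, Finset.prod_insert ha, reverse_mul_of_domain, ih, reverse_X_sub_C]

lemma map_reverse {F : Type*} [Field F] (θ : F →+* E) (p : F[X]) :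
    p.reverse.map θ = (p.map θ).reverse := by
  rw [reverse, reverse, reflect_map, natDegree_map]

lemma reverse_reverse_of_coeff_zero_ne_zero {p : E[X]} (hp : p.coeff 0 ≠ 0) :
    p.reverse.reverse = p := by
  have hdeg : p.reverse.natDegree = p.natDegree := by
    rw [reverse_natDegree, natTrailingDegree_eq_zero.2 (Or.inr hp), Nat.sub_zero]
  ext n
  rw [coeff_reverse, coeff_reverse, hdeg, revAt_invol]

lemma coeff_zero_ne_zero_of_natDegree_reverse_reverse {p : E[X]} (hp : p ≠ 0)
    (h : p.reverse.reverse.natDegree = p.natDegree) : p.coeff 0 ≠ 0 := by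
  have hrev : p.reverse.natTrailingDegree = 0 := natTrailingDegree_eq_zero.2 <| Or.inr <| by
    rwa [coeff_zero_reverse, leadingCoeff_ne_zero]
  rw [reverse_natDegree, hrev, Nat.sub_zero, reverse_natDegree] at h
  have hle := natTrailingDegree_le_natDegree p
  exact (natTrailingDegree_eq_zero.1 (by omega)).resolve_left hp

lemma coeff_prod_one_sub_C_mul_X [Fintype ι] (f : ι → E) (m : ℕ) :
    (∏ i, (1 - C (f i) * X)).coeff m =
      ∑ I ∈ Finset.powersetCard m Finset.univ, ∏ i ∈ I, -f i := by
  classical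
  have hterm (I : Finset ι) : ∏ i ∈ I, -(C (f i) * X : E[X]) = C (∏ i ∈ I, -f i) * X ^ I.card := by
    rw [map_prod, ← Finset.prod_const, ← Finset.prod_mul_distrib]
    exact Finset.prod_congr rfl fun i _ => by rw [C_neg, neg_mul]
  simp only [sub_eq_add_neg, Finset.prod_one_add, hterm, finsetSum_coeff, coeff_C_mul_X_pow,
    Finset.powersetCard_eq_filter, Finset.sum_filter, eq_comm, Finset.powerset_univ]

end Reverse

section PowerSums

open Finset

variable {F E ι : Type*} [Field F] [Field E] [Fintype ι] {θ : F →+* E} {P : F[X]} {a : E}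
  {r : ι → E}

lemma SplitsWithRoots.reverse_map (h : SplitsWithRoots θ P a r) :
    (P.map θ).reverse = C a * ∏ i, (1 - C (r i) * X) := by
  rw [h.map_eq, reverse_mul_of_domain, reverse_prod_X_sub_C, reverse_C]

lemma SplitsWithRoots.reverse_derivative_map [CharZero E] [DecidableEq ι]
    (h : SplitsWithRoots θ P a r) :
    (derivative (P.map θ)).reverse = C a * ∑ i, ∏ j ∈ univ.erase i, (1 - C (r j) * X) := by
  have hderiv : derivative (P.map θ) = C a * ∑ i, ∏ j ∈ univ.erase i, (X - C (r j)) := by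
    simp only [h.map_eq, derivative_C_mul, derivative_prod_finset, derivative_X_sub_C, mul_one]
  let reflectHom : E[X] →+ E[X] :=
    ⟨⟨reflect (Fintype.card ι - 1), reflect_zero⟩, fun f g => reflect_add f g _⟩
  rw [reverse, natDegree_derivative, natDegree_map, h.natDegree_eq, hderiv, reflect_C_mul]
  congr 1
  refine (map_sum reflectHom _ _).trans (sum_congr rfl fun i _ => ?_)
  have hcard : Fintype.card ι - 1 = (∏ j ∈ univ.erase i, (X - C (r j))).natDegree := by
    rw [natDegree_finsetProd_X_sub_C_eq_card, card_erase_of_mem (mem_univ i), card_univ]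
  rw [← reverse_prod_X_sub_C, reverse, ← hcard]
  rfl

lemma mk_pow_mul_one_sub {T : Type*} [CommRing T] (b : T) :
    (PowerSeries.mk fun m => b ^ m) * (1 - PowerSeries.C b * PowerSeries.X) = 1 := by
  have := congrArg (PowerSeries.rescale b) (PowerSeries.mk_one_mul_one_sub_eq_one T)
  rw [map_mul, map_sub, map_one, PowerSeries.rescale_X] at this
  refine Eq.trans (congrArg (· * _) (PowerSeries.ext fun m => ?_)) this
  rw [PowerSeries.coeff_rescale, PowerSeries.coeff_mk, PowerSeries.coeff_mk, Pi.one_apply, mul_one]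

lemma SplitsWithRoots.sum_mk_pow_mul_reverse [CharZero E] (h : SplitsWithRoots θ P a r) :
    (∑ i, PowerSeries.mk fun m => r i ^ m) * ((P.map θ).reverse : PowerSeries E) =
      ((derivative (P.map θ)).reverse : PowerSeries E) := by
  classical
  rw [h.reverse_map, h.reverse_derivative_map]
  simp only [← coeToPowerSeries.ringHom_apply, map_mul, map_sum, map_prod]
  rw [mul_left_comm, sum_mul]
  refine congrArg _ (sum_congr rfl fun i _ => ?_)
  rw [← mul_prod_erase univ _ (mem_univ i), ← mul_assoc]
  simp only [coeToPowerSeries.ringHom_apply, Polynomial.coe_sub, Polynomial.coe_one,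
    Polynomial.coe_mul, coe_C, coe_X]
  rw [mk_pow_mul_one_sub, one_mul]

lemma SplitsWithRoots.map_coeff_reverse_derivative_mul_inv [CharZero E]
    (h : SplitsWithRoots θ P a r) (m : ℕ) :
    θ (PowerSeries.coeff m (((derivative P).reverse : PowerSeries F) *
      (P.reverse : PowerSeries F)⁻¹)) = ∑ i, r i ^ m := by
  have hP0 : PowerSeries.constantCoeff (P.reverse : PowerSeries F) ≠ 0 := by
    simpa using h.ne_zero
  have hmul : PowerSeries.map θ (((derivative P).reverse : PowerSeries F) *
      (P.reverse : PowerSeries F)⁻¹) * ((P.map θ).reverse : PowerSeries E) =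
      ((derivative (P.map θ)).reverse : PowerSeries E) := by
    rw [derivative_map, ← map_reverse, ← map_reverse, polynomial_map_coe, polynomial_map_coe,
      ← map_mul, mul_assoc, PowerSeries.inv_mul_cancel _ hP0, mul_one]
  have hrev : ((P.map θ).reverse : PowerSeries E) ≠ 0 := by
    rw [Ne, coe_eq_zero_iff, reverse_eq_zero, Polynomial.map_eq_zero]
    exact h.ne_zero
  rw [← PowerSeries.coeff_map, mul_right_cancel₀ hrev (hmul.trans h.sum_mk_pow_mul_reverse.symm),
    map_sum]
  simp only [PowerSeries.coeff_mk]

end PowerSums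

section ExpSum

open Finset

variable {F E ι : Type*} [Field F] [Field E]

/-- Reduction of power series modulo `Xⁿ`. -/
abbrev modXPow (E : Type*) [Field E] (n : ℕ) :
    PowerSeries E →+* PowerSeries E ⧸ Ideal.span {(PowerSeries.X : PowerSeries E) ^ n} :=
  Ideal.Quotient.mk _

lemma modXPow_eq_iff {n : ℕ} {f g : PowerSeries E} :
    modXPow E n f = modXPow E n g ↔ ∀ m < n, PowerSeries.coeff m f = PowerSeries.coeff m g := by
  rw [Ideal.Quotient.eq, Ideal.mem_span_singleton, PowerSeries.X_pow_dvd_iff]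
  simp only [map_sub, sub_eq_zero]

lemma modXPow_rescale_congr {n : ℕ} {f g : PowerSeries E} (h : modXPow E n f = modXPow E n g)
    (b : E) : modXPow E n (PowerSeries.rescale b f) = modXPow E n (PowerSeries.rescale b g) := by
  rw [modXPow_eq_iff] at h ⊢
  intro m hm
  rw [PowerSeries.coeff_rescale, PowerSeries.coeff_rescale, h m hm]

/-- The series `∑_{n=1}^c (-1)^{n-1} S(n y) zⁿ / n` whose exponential is `expSum S c`. -/
def expSumExponent (S : PowerSeries F) (c : ℕ) : PowerSeries (PowerSeries F) :=
  ∑ n ∈ Icc 1 c, PowerSeries.monomial n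
    (((-1 : F) ^ (n - 1) / (n : F)) • PowerSeries.rescale (n : F) S)

lemma coeff_succ_expSumExponent (S : PowerSeries F) {n c : ℕ} (hn : n < c) :
    PowerSeries.coeff (n + 1) (expSumExponent S c) =
      ((-1 : F) ^ n / ((n + 1 : ℕ) : F)) • PowerSeries.rescale ((n + 1 : ℕ) : F) S := by
  rw [expSumExponent, map_sum, sum_eq_single_of_mem (n + 1) (mem_Icc.2 ⟨by omega, hn⟩),
    PowerSeries.coeff_monomial_same, Nat.add_sub_cancel]
  intro b _ hb
  rw [PowerSeries.coeff_monomial, if_neg hb.symm]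

lemma constantCoeff_expSumExponent (S : PowerSeries F) (c : ℕ) :
    PowerSeries.constantCoeff (expSumExponent S c) = 0 := by
  rw [← PowerSeries.coeff_zero_eq_constantCoeff_apply, expSumExponent, map_sum]
  refine sum_eq_zero fun n hn => ?_
  have := (mem_Icc.1 hn).1
  rw [PowerSeries.coeff_monomial, if_neg (by omega)]

lemma succ_mul_coeff_succ_expSumExponent [CharZero F] (S : PowerSeries F) {n c : ℕ} (hn : n < c) :
    ((n + 1 : ℕ) : PowerSeries F) * PowerSeries.coeff (n + 1) (expSumExponent S c) =
      (-1) ^ n * PowerSeries.rescale ((n + 1 : ℕ) : F) S := by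
  have hn0 : ((n + 1 : ℕ) : F) ≠ 0 := Nat.cast_ne_zero.2 n.succ_ne_zero
  rw [coeff_succ_expSumExponent S hn, PowerSeries.smul_eq_C_mul, ← mul_assoc,
    ← map_natCast PowerSeries.C, ← map_mul, mul_div_cancel₀ _ hn0, map_pow, map_neg, map_one]

variable [CharZero E]

lemma prod_rescale_exp (r : ι → E) (I : Finset ι) :
    ∏ i ∈ I, PowerSeries.rescale (r i) (PowerSeries.exp E) =
      PowerSeries.rescale (∑ i ∈ I, r i) (PowerSeries.exp E) := by
  classical
  induction I using Finset.induction_on with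
  | empty => simp
  | insert a s ha ih =>
    rw [prod_insert ha, sum_insert ha, ih, PowerSeries.exp_mul_exp_eq_exp_add]

/-- With `eᵢ = exp (rᵢ u)`, the series `S (n u)` is the `n`-th power sum of the `eᵢ`, so the
exponential produces the elementary symmetric functions of the `eᵢ`. -/
lemma modXPow_map_coeff_expSum [CharZero F] [Fintype ι] (θ : F →+* E) (r : ι → E)
    {S : PowerSeries F} {N : ℕ}
    (hS : modXPow E N (S.map θ) = modXPow E N (∑ i, PowerSeries.rescale (r i) (PowerSeries.exp E)))
    (c : ℕ) :
    modXPow E N ((PowerSeries.coeff c (expSum S c)).map θ) =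
      modXPow E N (∑ I ∈ powersetCard c univ,
        PowerSeries.rescale (∑ i ∈ I, r i) (PowerSeries.exp E)) := by
  refine (coeff_exp_subst_eq_sum_powersetCard_prod ((modXPow E N).comp (PowerSeries.map θ))
    (fun i => modXPow E N (PowerSeries.rescale (r i) (PowerSeries.exp E)))
    (constantCoeff_expSumExponent S c) c (fun n hn => ?_) le_rfl).trans ?_
  · have hrescale : (PowerSeries.rescale ((n + 1 : ℕ) : F) S).map θ =
        PowerSeries.rescale ((n + 1 : ℕ) : E) (S.map θ) := by
      ext m
      simp only [PowerSeries.coeff_map, PowerSeries.coeff_rescale, map_mul, map_pow, map_natCast]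
    rw [← map_natCast ((modXPow E N).comp (PowerSeries.map θ)), ← map_mul,
      succ_mul_coeff_succ_expSumExponent S hn, map_mul, map_pow, map_neg, map_one,
      RingHom.comp_apply, hrescale, modXPow_rescale_congr hS, map_sum, map_sum]
    congr 1
    refine sum_congr rfl fun i _ => ?_
    rw [← map_pow, ← map_pow, PowerSeries.exp_pow_eq_rescale_exp, PowerSeries.rescale_rescale,
      PowerSeries.rescale_rescale, mul_comm]
  · rw [map_sum]
    exact sum_congr rfl fun I _ => by rw [← prod_rescale_exp, map_prod]

end ExpSum

section PureComposedSum

open Finset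

variable {F E ι κ : Type*} [Field F] [Field E] [CharZero F] [CharZero E] [Fintype ι] [Fintype κ]

omit [CharZero F] in
lemma coeff_modPow {n m : ℕ} (h : m < n) (f : PowerSeries F) :
    PowerSeries.coeff m (modPow n f) = PowerSeries.coeff m f := by
  rw [modPow, PowerSeries.coeff_coe_trunc_of_lt h]

lemma trunc_exp_integralDivX_eq_prod (θ : F →+* E) (f : κ → E) {M : PowerSeries F}
    (hM : ∀ m ≤ Fintype.card κ, θ (PowerSeries.coeff m M) = ∑ i, f i ^ m) :
    (PowerSeries.trunc (Fintype.card κ + 1) ((PowerSeries.exp ℚ).subst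
      (integralDivX ((Fintype.card κ : PowerSeries F) - M)) : PowerSeries F)).map θ =
      ∏ i, (1 - C (f i) * X) := by
  have hconst : PowerSeries.constantCoeff (integralDivX ((Fintype.card κ : PowerSeries F) - M)) =
      0 := by
    rw [← PowerSeries.coeff_zero_eq_constantCoeff_apply, integralDivX, PowerSeries.coeff_mk,
      Nat.cast_zero, div_zero]
  ext m
  rw [coeff_map, PowerSeries.coeff_trunc, coeff_prod_one_sub_C_mul_X]
  split_ifs with hm
  · refine coeff_exp_subst_eq_sum_powersetCard_prod θ (fun i => -f i) hconst (Fintype.card κ)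
      (fun n hn => ?_) (by omega)
    have hn0 : ((n + 1 : ℕ) : E) ≠ 0 := Nat.cast_ne_zero.2 n.succ_ne_zero
    have hcard : PowerSeries.coeff (n + 1) (Fintype.card κ : PowerSeries F) = 0 := by
      rw [← map_natCast (PowerSeries.C (R := F)), PowerSeries.coeff_C, if_neg n.succ_ne_zero]
    rw [integralDivX, PowerSeries.coeff_mk, map_div₀, map_natCast, mul_div_cancel₀ _ hn0, map_sub,
      hcard, zero_sub, map_neg, hM _ hn, mul_sum, ← sum_neg_distrib]
    refine sum_congr rfl fun i _ => ?_
    rw [neg_pow (f i), ← mul_assoc, ← pow_add, (by ring : n + (n + 1) = 2 * n + 1),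
      pow_succ (-1 : E),
      pow_mul, neg_one_sq, one_pow, one_mul, neg_one_mul]
  · rw [map_zero, powersetCard_eq_empty.2 (by rw [card_univ]; omega), sum_empty]

/-- The series `M` of `pureComposedSum`, the generating series of the power sums of the sums of
`c` roots of `P`. -/
def composedPowerSums (P : F[X]) (c : ℕ) : PowerSeries F :=
  let D : ℕ := P.natDegree.choose c
  let N : PowerSeries F := modPow (D + 1)
    (((derivative P).reverse : PowerSeries F) * (P.reverse : PowerSeries F)⁻¹)
  let S : PowerSeries F := modPow (D + 1) (hadamard N (PowerSeries.exp F))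
  let E : PowerSeries F := modPow (D + 1) ((PowerSeries.trunc (c + 1) (expSum S c)).coeff c)
  modPow (D + 1) (hadamard E (PowerSeries.mk fun n => (n.factorial : F)))

lemma pureComposedSum_eq (P : F[X]) (c : ℕ) :
    pureComposedSum P c = (PowerSeries.trunc (P.natDegree.choose c + 1) ((PowerSeries.exp ℚ).subst
      (integralDivX (((P.natDegree.choose c : ℕ) : PowerSeries F) - composedPowerSums P c)) :
        PowerSeries F)).reverse :=
  rfl

namespace SplitsWithRoots

variable {θ : F →+* E} {P : F[X]} {a : E} {r : ι → E}

lemma modXPow_map_hadamard_exp (h : SplitsWithRoots θ P a r) (n : ℕ) :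
    modXPow E n ((modPow n (hadamard (modPow n (((derivative P).reverse : PowerSeries F) *
      (P.reverse : PowerSeries F)⁻¹)) (PowerSeries.exp F))).map θ) =
      modXPow E n (∑ i, PowerSeries.rescale (r i) (PowerSeries.exp E)) := by
  refine modXPow_eq_iff.2 fun m hm => ?_
  rw [PowerSeries.coeff_map, coeff_modPow hm, hadamard, PowerSeries.coeff_mk, coeff_modPow hm,
    map_mul, h.map_coeff_reverse_derivative_mul_inv, ← PowerSeries.coeff_map, PowerSeries.map_exp,
    map_sum, sum_mul]
  simp only [PowerSeries.coeff_rescale]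

lemma map_coeff_composedPowerSums (h : SplitsWithRoots θ P a r) {c m : ℕ}
    (hm : m ≤ P.natDegree.choose c) :
    θ (PowerSeries.coeff m (composedPowerSums P c)) =
      ∑ I ∈ powersetCard c univ, (∑ i ∈ I, r i) ^ m := by
  have hm' := Nat.lt_succ_of_le hm
  have hfact : (m.factorial : E) ≠ 0 := Nat.cast_ne_zero.2 m.factorial_ne_zero
  have hexp : PowerSeries.coeff m (PowerSeries.exp E) * (m.factorial : E) = 1 := by
    rw [PowerSeries.coeff_exp, one_div, map_inv₀, map_natCast, inv_mul_cancel₀ hfact]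
  have hE := modXPow_eq_iff.1
    (modXPow_map_coeff_expSum θ r (h.modXPow_map_hadamard_exp (P.natDegree.choose c + 1)) c) m hm'
  rw [composedPowerSums, coeff_modPow hm', hadamard, PowerSeries.coeff_mk, coeff_modPow hm',
    PowerSeries.coeff_trunc, if_pos (Nat.lt_succ_self c), map_mul, ← PowerSeries.coeff_map, hE,
    PowerSeries.coeff_mk, map_natCast, map_sum, sum_mul]
  refine sum_congr rfl fun I _ => ?_
  rw [PowerSeries.coeff_rescale, mul_assoc, hexp, mul_one]

/-- The double reversal removes the factors `X` coming from vanishing sums. -/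
lemma map_pureComposedSum (h : SplitsWithRoots θ P a r) (c : ℕ) :
    (pureComposedSum P c).map θ =
      (∏ I ∈ powersetCard c univ, (X - C (∑ i ∈ I, r i))).reverse.reverse := by
  have hcard : Fintype.card (powersetCard c (univ : Finset ι)) = P.natDegree.choose c := by
    rw [Fintype.card_coe, card_powersetCard, card_univ, h.natDegree_eq]
  rw [pureComposedSum_eq, map_reverse, reverse_prod_X_sub_C, ← hcard,
    trunc_exp_integralDivX_eq_prod θ (fun I : powersetCard c (univ : Finset ι) => ∑ i ∈ I.1, r i),
    prod_coe_sort _ fun I => 1 - C (∑ i ∈ I, r i) * X]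
  intro m hm
  rw [h.map_coeff_composedPowerSums (hcard ▸ hm),
    sum_coe_sort _ fun I => (∑ i ∈ I, r i) ^ m]

lemma map_pureComposedSum_of_ne_zero (h : SplitsWithRoots θ P a r) {c : ℕ}
    (hr : ∀ I ∈ powersetCard c univ, ∑ i ∈ I, r i ≠ 0) :
    (pureComposedSum P c).map θ = ∏ I ∈ powersetCard c univ, (X - C (∑ i ∈ I, r i)) := by
  rw [h.map_pureComposedSum, reverse_reverse_of_coeff_zero_ne_zero]
  rw [coeff_zero_eq_eval_zero, eval_prod, prod_ne_zero_iff]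
  intro I hI
  rw [eval_sub, eval_X, eval_C, zero_sub, neg_ne_zero]
  exact hr I hI

lemma map_pureComposedSum_of_natDegree (h : SplitsWithRoots θ P a r) {c : ℕ}
    (hdeg : (pureComposedSum P c).natDegree = (Fintype.card ι).choose c) :
    (pureComposedSum P c).map θ = ∏ I ∈ powersetCard c univ, (X - C (∑ i ∈ I, r i)) := by
  rw [h.map_pureComposedSum, reverse_reverse_of_coeff_zero_ne_zero]
  refine coeff_zero_ne_zero_of_natDegree_reverse_reverse
    (monic_prod_of_monic _ _ fun i _ => monic_X_sub_C _).ne_zero ?_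
  rw [← h.map_pureComposedSum, natDegree_map, hdeg, natDegree_finsetProd_X_sub_C_eq_card,
    card_powersetCard, card_univ]

end SplitsWithRoots

end PureComposedSum

section SimpleResidue

variable {E ι : Type*} [Field E]

/-- The residue of `p / q` at a simple root `y` of `q`. -/
def simpleResidue (p q : E[X]) (y : E) : E :=
  p.eval y / (derivative q).eval y

lemma map_simpleResidue {E' : Type*} [Field E'] (τ : E →+* E') (p q : E[X]) (y : E) :
    τ (simpleResidue p q y) = simpleResidue (p.map τ) (q.map τ) (τ y) := by
  rw [simpleResidue, simpleResidue, map_div₀, derivative_map, eval_map_apply, eval_map_apply]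

lemma simpleResidue_eq_of_mul_eq {p q a b : E[X]} {y : E} (hb : b.eval y ≠ 0)
    (hq : (derivative q).eval y ≠ 0) (h : p * b = a * derivative q) :
    simpleResidue p q y = a.eval y / b.eval y := by
  rw [simpleResidue, div_eq_div_iff hq hb, ← eval_mul, ← eval_mul, h]

/-- Lagrange interpolation of `p` at the roots computes the residue of `p / P` at infinity. -/
lemma SplitsWithRoots.sum_simpleResidue {F : Type*} [CommRing F] [Fintype ι] {θ : F →+* E}
    {P : F[X]} {l : E} {r : ι → E} (h : SplitsWithRoots θ P l r) (hr : Function.Injective r)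
    {p : E[X]} (hp : p.degree < Fintype.card ι) :
    ∑ i, simpleResidue p (P.map θ) (r i) = p.coeff (Fintype.card ι - 1) / l := by
  classical
  rw [← Finset.card_univ, Lagrange.coeff_eq_sum hr.injOn (by rwa [Finset.card_univ]),
    Finset.sum_div]
  refine Finset.sum_congr rfl fun i _ => ?_
  rw [simpleResidue, h.eval_derivative, div_div, mul_comm]

end SimpleResidue

section AlgebraicResidues

variable {F : Type*} [Field F]

lemma eval_X_map_algebraMap (p : F[X]) :
    (p.map (algebraMap F (RatFunc F))).eval RatFunc.X = algebraMap F[X] (RatFunc F) p := by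
  rw [eval_map_algebraMap, ← RatFunc.algebraMap_X, aeval_algebraMap_apply, aeval_X_left_apply]

lemma coeff_zero_shift (p : F[X]) : (shift p).coeff 0 = algebraMap F[X] (RatFunc F) p := by
  rw [shift, taylor_coeff_zero, eval_X_map_algebraMap]

lemma coeff_zero_diffQuot (q : F[X]) :
    (diffQuot q).coeff 0 = algebraMap F[X] (RatFunc F) (derivative q) := by
  rw [diffQuot, coeff_divX, coeff_sub, zero_add, coeff_C_succ, sub_zero, shift, taylor_coeff_one,
    derivative_map, eval_X_map_algebraMap]

lemma coeff_zero_residueSeries (P : F[X]) {Q : F[X]} (hQ : Q ≠ 0) :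
    PowerSeries.coeff 0 (residueSeries P Q Q 1) =
      algebraMap F[X] (RatFunc F) P / algebraMap F[X] (RatFunc F) (derivative Q) := by
  rw [residueSeries, pow_one, pow_one, EuclideanDomain.div_self hQ,
    PowerSeries.coeff_zero_eq_constantCoeff_apply, map_mul, PowerSeries.constantCoeff_inv,
    ← PowerSeries.coeff_zero_eq_constantCoeff_apply,
    ← PowerSeries.coeff_zero_eq_constantCoeff_apply,
    Polynomial.coeff_coe, Polynomial.coeff_coe, mul_coeff_zero, coeff_zero_shift, coeff_zero_shift,
    coeff_zero_diffQuot, map_one, one_mul, div_eq_mul_inv]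

lemma IsSquarefreeDecomposition.eq_of_squarefree {Q : F[X]} (hQ : Squarefree Q) {m : ℕ}
    {q : ℕ → F[X]} (h : IsSquarefreeDecomposition Q m q) : m = 1 ∧ q 1 = Q := by
  have hm : m = 1 := by
    have hdvd : q m ^ m ∣ Q := by
      rw [h.prod_eq]
      exact Finset.dvd_prod_of_mem (fun i => q i ^ i) (Finset.mem_Icc.2 ⟨h.one_le, le_rfl⟩)
    by_contra hne
    have hsq : q m * q m ∣ Q := by
      rw [← pow_two]
      exact (pow_dvd_pow _ (by have := h.one_le; omega)).trans hdvd
    exact h.natDegree_pos.ne' (natDegree_eq_zero_of_isUnit (hQ _ hsq))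
  subst hm
  have hprod := h.prod_eq
  rw [Finset.Icc_self, Finset.prod_singleton, pow_one] at hprod
  exact ⟨rfl, hprod.symm⟩

lemma IsSquarefreeDecomposition.of_squarefree {Q : F[X]} (hQ : Squarefree Q)
    (hdeg : 0 < Q.natDegree) : IsSquarefreeDecomposition Q 1 fun _ => Q where
  one_le := le_rfl
  prod_eq := by rw [Finset.Icc_self, Finset.prod_singleton, pow_one]
  squarefree _ _ := hQ
  coprime i hi j hj hij := by
    rw [Finset.Icc_self, Finset.mem_singleton] at hi hj
    exact absurd (hi.trans hj.symm) hij
  natDegree_pos := hdeg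

lemma isResidueFactor_one_iff {P Q r : F[X]} (hdeg : 0 < Q.natDegree) :
    IsResidueFactor P Q Q 1 r ↔ ∃ a b : F[X], b ≠ 0 ∧ IsCoprime a b ∧
      algebraMap F[X] (RatFunc F) P / algebraMap F[X] (RatFunc F) (derivative Q) =
        algebraMap F[X] (RatFunc F) a / algebraMap F[X] (RatFunc F) b ∧
      r = residueResultant a b Q := by
  rw [IsResidueFactor, or_iff_right fun h => hdeg.ne' h.1, and_iff_right hdeg.ne', Nat.sub_self,
    coeff_zero_residueSeries P (ne_zero_of_natDegree_gt hdeg)]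

lemma exists_isAlgebraicResidues (P : F[X]) {Q : F[X]} (hQ : Squarefree Q)
    (hdeg : 0 < Q.natDegree) : ∃ R, IsAlgebraicResidues P Q R := by
  let x := algebraMap F[X] (RatFunc F) P / algebraMap F[X] (RatFunc F) (derivative Q)
  refine ⟨residueResultant x.num x.denom Q, 1, fun _ => Q,
    fun _ => residueResultant x.num x.denom Q, .of_squarefree hQ hdeg, fun i hi => ?_, ?_⟩
  · obtain rfl : i = 1 := by rwa [Finset.Icc_self, Finset.mem_singleton] at hi
    exact (isResidueFactor_one_iff hdeg).2
      ⟨x.num, x.denom, x.denom_ne_zero, x.isCoprime_num_denom, x.num_div_denom.symm, rfl⟩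
  · rw [Finset.Icc_self, Finset.prod_singleton]

lemma IsAlgebraicResidues.exists_eq_residueResultant {P Q R : F[X]}
    (h : IsAlgebraicResidues P Q R) (hQ : Squarefree Q) (hdeg : 0 < Q.natDegree)
    (hderiv : derivative Q ≠ 0) :
    ∃ a b : F[X], b ∣ derivative Q ∧ P * b = a * derivative Q ∧ R = residueResultant a b Q := by
  obtain ⟨m, q, r, hdecomp, hr, rfl⟩ := h
  obtain ⟨rfl, rfl⟩ := hdecomp.eq_of_squarefree hQ
  obtain ⟨a, b, hb, hab, hfrac, hres⟩ := (isResidueFactor_one_iff hdeg).1 (hr 1 (by simp))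
  have hinj := IsFractionRing.injective F[X] (RatFunc F)
  rw [div_eq_div_iff ((map_ne_zero_iff _ hinj).2 hderiv) ((map_ne_zero_iff _ hinj).2 hb),
    ← map_mul, ← map_mul] at hfrac
  refine ⟨a, b, hab.symm.dvd_of_dvd_mul_left ⟨P, ?_⟩, hinj hfrac, ?_⟩
  · rw [← hinj hfrac, mul_comm]
  · rw [Finset.Icc_self, Finset.prod_singleton, hres]

variable {E ι : Type*} [Field E] [Fintype ι] {θ : F →+* E}

lemma map_residueResultant (a b : F[X]) {q : F[X]} {l : E} {Y : ι → E}
    (h : SplitsWithRoots θ q l Y) :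
    ∃ u : E, u ≠ 0 ∧ (residueResultant a b q).map θ =
      C u * ∏ i, (C ((a.map θ).eval (Y i)) - X * C ((b.map θ).eval (Y i))) := by
  have hC : (mapRingHom θ).comp C = C.comp θ := RingHom.ext fun x => by simp
  let f : F[X][X] := a.map C - C X * b.map C
  have hf : f.map (mapRingHom θ) = (a.map θ).map C - C X * (b.map θ).map C := by
    simp only [f, Polynomial.map_sub, Polynomial.map_mul, Polynomial.map_map, map_C, hC,
      coe_mapRingHom, map_X]
  have hq : (q.map C).map (mapRingHom θ) = C (C l) * ∏ i, (X - C (C (Y i))) := by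
    rw [Polynomial.map_map, hC, ← Polynomial.map_map, h.map_eq]
    simp only [Polynomial.map_mul, Polynomial.map_prod, Polynomial.map_sub, map_C, map_X]
  have hdeg : q.natDegree = (∏ i : ι, (X - C (C (Y i))) : E[X][X]).natDegree := by
    rw [h.natDegree_eq, natDegree_finsetProd_X_sub_C_eq_card, Finset.card_univ]
  have hfdeg : (f.map (mapRingHom θ)).natDegree ≤ f.natDegree := natDegree_map_le
  have hfactor (i : ι) : (f.map (mapRingHom θ)).resultant (X - C (C (Y i))) f.natDegree =
      C ((-1) ^ f.natDegree) * (C ((a.map θ).eval (Y i)) - X * C ((b.map θ).eval (Y i))) := by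
    rw [natDegree_X_sub_C, resultant_X_sub_C_right _ _ _ hfdeg, hf]
    simp [eval_map]
  refine ⟨l ^ f.natDegree * ((-1) ^ f.natDegree) ^ Fintype.card ι,
    mul_ne_zero (pow_ne_zero _ h.leadingCoeff_ne_zero)
      (pow_ne_zero _ (pow_ne_zero _ (neg_ne_zero.2 one_ne_zero))), ?_⟩
  calc (residueResultant a b q).map θ
      = C l ^ f.natDegree *
          ∏ i : ι, (f.map (mapRingHom θ)).resultant (X - C (C (Y i))) f.natDegree := by
        rw [← coe_mapRingHom, residueResultant, ← resultant_map_map, hq,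
          natDegree_map_eq_of_injective C_injective, resultant_C_mul_right, hdeg,
          resultant_prod_right _ _ _ _ hfdeg (by simp)]
    _ = _ := by
        simp only [hfactor]
        rw [Finset.prod_mul_distrib, Finset.prod_const, ← mul_assoc, Finset.card_univ]
        simp only [map_mul, map_pow]

theorem IsAlgebraicResidues.exists_splitsWithRoots [Nonempty ι] {P Q R : F[X]}
    (h : IsAlgebraicResidues P Q R) {l : E} {Y : ι → E} (hQ : SplitsWithRoots θ Q l Y)
    (hY : Function.Injective Y) (hsq : Squarefree Q) :
    ∃ u, SplitsWithRoots θ R u fun i => simpleResidue (P.map θ) (Q.map θ) (Y i) := by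
  have hderiv (i : ι) : (derivative (Q.map θ)).eval (Y i) ≠ 0 := hQ.eval_derivative_ne_zero hY i
  have hderiv_ne_zero : derivative Q ≠ 0 := fun h0 =>
    hderiv (Classical.arbitrary ι) (by rw [derivative_map, h0, Polynomial.map_zero, eval_zero])
  obtain ⟨a, b, ⟨w, hw⟩, hab, rfl⟩ := h.exists_eq_residueResultant hsq
    (by rw [hQ.natDegree_eq]; exact Fintype.card_pos) hderiv_ne_zero
  have hb (i : ι) : (b.map θ).eval (Y i) ≠ 0 := fun h0 => hderiv i <| by
    rw [derivative_map, hw, Polynomial.map_mul, eval_mul, h0, zero_mul]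
  have hresidue (i : ι) : simpleResidue (P.map θ) (Q.map θ) (Y i) =
      (a.map θ).eval (Y i) / (b.map θ).eval (Y i) :=
    simpleResidue_eq_of_mul_eq (hb i) (hderiv i) <| by
      rw [derivative_map, ← Polynomial.map_mul, ← Polynomial.map_mul, hab]
  obtain ⟨u, hu, hres⟩ := map_residueResultant a b hQ
  refine ⟨u * ∏ i, -(b.map θ).eval (Y i), mul_ne_zero hu
    (Finset.prod_ne_zero_iff.2 fun i _ => neg_ne_zero.2 (hb i)), ?_⟩
  rw [hres, C_mul, mul_assoc, map_prod, ← Finset.prod_mul_distrib]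
  refine congrArg (C u * ·) (Finset.prod_congr rfl fun i _ => ?_)
  have hfactor : C ((b.map θ).eval (Y i)) * C ((a.map θ).eval (Y i) / (b.map θ).eval (Y i)) =
      C ((a.map θ).eval (Y i)) := by
    rw [← C_mul, mul_div_cancel₀ _ (hb i)]
  rw [hresidue, C_neg]
  linear_combination -hfactor

end AlgebraicResidues

section Symmetry

open Finset

variable {K E ι : Type*} [Field K] [Field E] {θ : K →+* E}

lemma SplitsWithRoots.irreducible_of_transitive [Fintype ι] [Nonempty ι] {f : K[X]} {a : E}
    {z : ι → E} (hf : SplitsWithRoots θ f a z) (hz : Function.Injective z)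
    (htrans : ∀ i j, ∃ τ : E →+* E, τ.comp θ = θ ∧ τ (z i) = z j) : Irreducible f := by
  have hunit : ¬IsUnit f := fun hu =>
    Fintype.card_ne_zero (hf.natDegree_eq.symm.trans (natDegree_eq_zero_of_isUnit hu))
  obtain ⟨g, hg, h, rfl⟩ := WfDvdMonoid.exists_irreducible_factor hunit hf.ne_zero
  have hh : h ≠ 0 := right_ne_zero_of_mul hf.ne_zero
  have hcard := hf.natDegree_eq
  rw [natDegree_mul hg.ne_zero hh] at hcard
  have card_le {p : K[X]} (hp : p ≠ 0) (hroot : ∀ i, (p.map θ).eval (z i) = 0) :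
      Fintype.card ι ≤ p.natDegree := by
    by_contra! hlt
    rw [← natDegree_map θ] at hlt
    exact hp ((Polynomial.map_eq_zero θ).1
      (eq_zero_of_natDegree_lt_card_of_eval_eq_zero _ hz hroot hlt))
  obtain ⟨i, hi⟩ : ∃ i, (g.map θ).eval (z i) = 0 := by
    by_contra! hroot
    have := card_le hh fun i =>
      (mul_eq_zero.1 ((eval_mul.symm.trans (congrArg _ (Polynomial.map_mul θ).symm)).trans
        (hf.isRoot i))).resolve_left (hroot i)
    have := hg.natDegree_pos
    omega
  have := card_le hg.ne_zero fun j => by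
    obtain ⟨τ, hτ, hτz⟩ := htrans i j
    rw [← hτz, ← hτ, ← Polynomial.map_map, eval_map_apply, hi, map_zero]
  refine (irreducible_mul_isUnit ?_).2 hg
  rw [isUnit_iff_degree_eq_zero, degree_eq_natDegree hh, (by omega : h.natDegree = 0),
    Nat.cast_zero]

/-- The elements `r i` can be permuted arbitrarily by endomorphisms of `E` that fix the image of
`θ : K →+* E`. -/
def AdmitsPerms (θ : K →+* E) (r : ι → E) : Prop :=
  ∀ σ : Equiv.Perm ι, ∃ τ : E →+* E, τ.comp θ = θ ∧ ∀ i, τ (r i) = r (σ i)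

lemma AdmitsPerms.injective {r : ι → E} (hr : AdmitsPerms θ r) {i₀ j₀ : ι} (hne : r i₀ ≠ r j₀) :
    Function.Injective r := by
  classical
  intro i j hij
  by_contra hij_ne
  have hconst (x : ι) : r x = r i := by
    rcases eq_or_ne x i with rfl | hx
    · rfl
    obtain ⟨τ, -, hτ⟩ := hr (Equiv.swap j x)
    have hmap := congrArg τ hij
    rw [hτ, hτ, Equiv.swap_apply_left, Equiv.swap_apply_of_ne_of_ne hij_ne hx.symm] at hmap
    exact hmap.symm
  exact hne ((hconst i₀).trans (hconst j₀).symm)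

lemma sum_comp_swap {M : Type*} [AddCommGroup M] [DecidableEq ι] (r : ι → M) {I : Finset ι}
    {i j : ι} (hi : i ∈ I) (hj : j ∉ I) :
    ∑ x ∈ I, r (Equiv.swap i j x) = ∑ x ∈ I, r x - r i + r j := by
  rw [← add_sum_erase I _ hi, ← add_sum_erase I r hi, Equiv.swap_apply_left, add_sub_cancel_left,
    add_comm]
  refine congrArg (· + r j) (sum_congr rfl fun x hx => ?_)
  rw [Equiv.swap_apply_of_ne_of_ne (ne_of_mem_erase hx)
    (ne_of_mem_of_not_mem (mem_of_mem_erase hx) hj)]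

/-- Apply to both sides an endomorphism exchanging `r i` and `r j`, where `i ∈ I \ J` and
`j ∈ J \ I`: the two sides then differ by `2 (r j - r i)`. -/
lemma AdmitsPerms.eq_of_sum_eq [CharZero E] {r : ι → E} (hr : AdmitsPerms θ r)
    (hinj : Function.Injective r) {I J : Finset ι} (hcard : I.card = J.card)
    (hsum : ∑ i ∈ I, r i = ∑ i ∈ J, r i) : I = J := by
  classical
  by_contra hne
  obtain ⟨i, hiI, hiJ⟩ := Finset.not_subset.1 fun h => hne (eq_of_subset_of_card_le h hcard.ge)
  obtain ⟨j, hjJ, hjI⟩ :=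
    Finset.not_subset.1 fun h => hne (eq_of_subset_of_card_le h hcard.le).symm
  obtain ⟨τ, -, hτ⟩ := hr (Equiv.swap i j)
  have hmap := congrArg τ hsum
  simp only [map_sum, hτ] at hmap
  rw [sum_comp_swap r hiI hjI, Equiv.swap_comm, sum_comp_swap r hjJ hiJ, hsum] at hmap
  have hij : (2 : E) * (r i - r j) = 0 := by linear_combination -hmap
  rw [mul_eq_zero, or_iff_right two_ne_zero, sub_eq_zero] at hij
  exact hiJ (hinj hij ▸ hjJ)

lemma exists_perm_map_eq [Finite ι] {I J : Finset ι} (h : I.card = J.card) :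
    ∃ σ : Equiv.Perm ι, I.map σ.toEmbedding = J := by
  classical
  let e : {x // x ∈ I} ≃ {x // x ∈ J} := Finset.equivOfCardEq h
  refine ⟨e.extendSubtype, eq_of_subset_of_card_le (fun y hy => ?_) (by rw [card_map, h])⟩
  obtain ⟨x, hx, rfl⟩ := mem_map.1 hy
  exact e.extendSubtype_mem x hx

lemma AdmitsPerms.exists_map_sum_eq [Finite ι] {r : ι → E} (hr : AdmitsPerms θ r)
    {I J : Finset ι} (hcard : I.card = J.card) :
    ∃ τ : E →+* E, τ.comp θ = θ ∧ τ (∑ i ∈ I, r i) = ∑ i ∈ J, r i := by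
  obtain ⟨σ, rfl⟩ := exists_perm_map_eq hcard
  obtain ⟨τ, hτθ, hτ⟩ := hr σ
  refine ⟨τ, hτθ, ?_⟩
  rw [map_sum, sum_map]
  exact sum_congr rfl fun i _ => hτ i

variable [Fintype ι]

lemma AdmitsPerms.sum_ne_zero [CharZero E] {r : ι → E} (hr : AdmitsPerms θ r)
    (hinj : Function.Injective r) {c : ℕ} (hc : 0 < c) (hc' : c < Fintype.card ι) {I : Finset ι}
    (hI : I ∈ powersetCard c univ) : ∑ i ∈ I, r i ≠ 0 := by
  classical
  rw [mem_powersetCard_univ] at hI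
  obtain ⟨i, hi⟩ := card_pos.1 (hI ▸ hc)
  obtain ⟨j, hj⟩ : ∃ j, j ∉ I := by
    by_contra! hall
    rw [eq_univ_of_forall hall, card_univ] at hI
    omega
  have hcard : I.card = (I.map (Equiv.swap i j).toEmbedding).card := (card_map _).symm
  obtain ⟨τ, -, hτ⟩ := hr.exists_map_sum_eq hcard
  intro h0
  rw [h0, map_zero] at hτ
  have hmem : j ∈ I.map (Equiv.swap i j).toEmbedding :=
    mem_map.2 ⟨i, hi, Equiv.swap_apply_left i j⟩
  rw [← hr.eq_of_sum_eq hinj hcard (h0.trans hτ)] at hmem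
  exact hj hmem

theorem AdmitsPerms.irreducible_pureComposedSum [CharZero K] [CharZero E] {R : K[X]} {u : E}
    {r : ι → E} (hr : AdmitsPerms θ r) (hinj : Function.Injective r)
    (hR : SplitsWithRoots θ R u r) {c : ℕ} (hc : 0 < c) (hc' : c < Fintype.card ι) :
    Irreducible (pureComposedSum R c) ∧
      (pureComposedSum R c).natDegree = (Fintype.card ι).choose c := by
  have hsplits : SplitsWithRoots θ (pureComposedSum R c) 1
      fun I : powersetCard c (univ : Finset ι) => ∑ i ∈ I.1, r i :=
    ⟨one_ne_zero, by
      rw [hR.map_pureComposedSum_of_ne_zero fun I hI => hr.sum_ne_zero hinj hc hc' hI, C_1,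
        one_mul, ← Finset.prod_coe_sort]⟩
  have hcard (I J : powersetCard c (univ : Finset ι)) : I.1.card = J.1.card := by
    rw [mem_powersetCard_univ.1 I.2, mem_powersetCard_univ.1 J.2]
  have : Nonempty (powersetCard c (univ : Finset ι)) := by
    rw [nonempty_coe_sort, powersetCard_nonempty, card_univ]
    exact hc'.le
  refine ⟨hsplits.irreducible_of_transitive
    (fun I J h => Subtype.ext (hr.eq_of_sum_eq hinj (hcard I J) h))
    fun I J => hr.exists_map_sum_eq (hcard I J), ?_⟩
  rw [hsplits.natDegree_eq, Fintype.card_coe, card_powersetCard, card_univ]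

/-- Over `θ : K →+* E`, the polynomial `Q` has the distinct roots `Y i` and leading coefficient `l`,
and every permutation of the roots is induced by an endomorphism of `E` over `K`. -/
structure HasSymmetricRoots (θ : K →+* E) (Q : K[X]) (l : E) (Y : ι → E) : Prop
    extends SplitsWithRoots θ Q l Y where
  injective : Function.Injective Y
  admitsPerms : AdmitsPerms θ Y

namespace HasSymmetricRoots

variable {Q : K[X]} {l : E} {Y : ι → E}

lemma C_mul (h : HasSymmetricRoots θ Q l Y) {b : K} (hb : b ≠ 0) :
    HasSymmetricRoots θ (C b * Q) (θ b * l) Y :=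
  ⟨h.toSplitsWithRoots.C_mul ((map_ne_zero θ).2 hb), h.injective, h.admitsPerms⟩

lemma irreducible [Nonempty ι] (h : HasSymmetricRoots θ Q l Y) : Irreducible Q := by
  classical
  refine h.irreducible_of_transitive h.injective fun i j => ?_
  obtain ⟨τ, hτθ, hτ⟩ := h.admitsPerms (Equiv.swap i j)
  exact ⟨τ, hτθ, by rw [hτ, Equiv.swap_apply_left]⟩

lemma admitsPerms_simpleResidue (h : HasSymmetricRoots θ Q l Y) (P : K[X]) :
    AdmitsPerms θ fun i => simpleResidue (P.map θ) (Q.map θ) (Y i) := by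
  intro σ
  obtain ⟨τ, hτθ, hτ⟩ := h.admitsPerms σ
  refine ⟨τ, hτθ, fun i => ?_⟩
  rw [map_simpleResidue, Polynomial.map_map, Polynomial.map_map, hτθ, hτ]

/-- If all residues were equal, they would vanish, since their sum is the residue of `P / Q` at
infinity, which is `0`; but `P` has fewer zeros than `Q`. -/
lemma injective_simpleResidue [CharZero E] [Nonempty ι] (h : HasSymmetricRoots θ Q l Y) {P : K[X]}
    (hP : P ≠ 0) (hPdeg : P.natDegree + 2 ≤ Fintype.card ι) :
    Function.Injective fun i => simpleResidue (P.map θ) (Q.map θ) (Y i) := by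
  suffices hne : ∃ i j, simpleResidue (P.map θ) (Q.map θ) (Y i) ≠
      simpleResidue (P.map θ) (Q.map θ) (Y j) by
    obtain ⟨i, j, hij⟩ := hne
    exact (h.admitsPerms_simpleResidue P).injective hij
  by_contra! hconst
  have hsum : ∑ i, simpleResidue (P.map θ) (Q.map θ) (Y i) = 0 := by
    rw [h.sum_simpleResidue h.injective, coeff_map, coeff_eq_zero_of_natDegree_lt (by omega),
      map_zero, zero_div]
    rw [degree_map, degree_eq_natDegree hP]
    exact_mod_cast (by omega : P.natDegree < Fintype.card ι)
  have hzero (i : ι) : simpleResidue (P.map θ) (Q.map θ) (Y i) = 0 := by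
    rw [sum_congr rfl fun j _ => hconst j i, sum_const, card_univ, nsmul_eq_mul] at hsum
    exact (mul_eq_zero.1 hsum).resolve_left (Nat.cast_ne_zero.2 Fintype.card_ne_zero)
  refine hP ((Polynomial.map_eq_zero θ).1
    (eq_zero_of_natDegree_lt_card_of_eval_eq_zero _ h.injective (fun i => ?_) ?_))
  · exact (div_eq_zero_iff.1 (hzero i)).resolve_right (h.eval_derivative_ne_zero h.injective i)
  · rw [natDegree_map]
    omega

theorem irreducible_pureComposedSum [CharZero K] [CharZero E] (h : HasSymmetricRoots θ Q l Y)
    {P R : K[X]} (hP : P ≠ 0) (hPdeg : P.natDegree + 2 ≤ Fintype.card ι)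
    (hR : IsAlgebraicResidues P Q R) {c : ℕ} (hc : 0 < c) (hc' : c < Fintype.card ι) :
    Irreducible (pureComposedSum R c) ∧
      (pureComposedSum R c).natDegree = (Fintype.card ι).choose c := by
  have : Nonempty ι := Fintype.card_pos_iff.1 (by omega)
  obtain ⟨u, hRsplits⟩ :=
    hR.exists_splitsWithRoots h.toSplitsWithRoots h.injective h.irreducible.squarefree
  exact (h.admitsPerms_simpleResidue P).irreducible_pureComposedSum
    (h.injective_simpleResidue hP hPdeg) hRsplits hc hc'

end HasSymmetricRoots

end Symmetry

section DiagNumer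

variable {k : Type*} [Field k]

/-- The polynomial `y^N A(t / y, y)`, for `N` at least the degree of `A` in the first variable. -/
def diagNumer (N : ℕ) : MvPolynomial (Fin 2) k →ₗ[k] k[X][X] :=
  (MvPolynomial.basisMonomials (Fin 2) k).constr k fun s =>
    C (X ^ s 0) * X ^ (s 1 + N - s 0)

lemma diagNumer_monomial (N : ℕ) (s : Fin 2 →₀ ℕ) (a : k) :
    diagNumer N (MvPolynomial.monomial s a) = C (C a * X ^ s 0) * X ^ (s 1 + N - s 0) := by
  have h : MvPolynomial.monomial s a = a • MvPolynomial.basisMonomials (Fin 2) k s := by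
    rw [MvPolynomial.coe_basisMonomials, MvPolynomial.smul_monomial, smul_eq_mul, mul_one]
  rw [h, map_smul, diagNumer, Module.Basis.constr_basis, C_mul, mul_assoc, Algebra.smul_def]
  rfl

lemma diagNumer_eq_sum (N : ℕ) (A : MvPolynomial (Fin 2) k) : diagNumer N A =
    ∑ s ∈ A.support, C (C (A.coeff s) * X ^ s 0) * X ^ (s 1 + N - s 0) := by
  conv_lhs => rw [A.as_sum]
  simp only [map_sum, diagNumer_monomial]

lemma C_mul_X_pow_mul_X_pow_eq_monomial (a : k) (i j : ℕ) :
    MvPolynomial.C a * MvPolynomial.X 0 ^ i * MvPolynomial.X 1 ^ j =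
      MvPolynomial.monomial (Finsupp.single (0 : Fin 2) i + Finsupp.single 1 j) a := by
  rw [MvPolynomial.monomial_eq, Finsupp.prod_fintype _ _ (by simp), Fin.prod_univ_two]
  simp [mul_assoc]

lemma diagNumer_C_mul_X_pow (N i j : ℕ) (a : k) :
    diagNumer N (MvPolynomial.C a * MvPolynomial.X 0 ^ i * MvPolynomial.X 1 ^ j) =
      C (C a * X ^ i) * X ^ (j + N - i) := by
  rw [C_mul_X_pow_mul_X_pow_eq_monomial, diagNumer_monomial]
  simp

lemma eq_single_add_single_iff (s : Fin 2 →₀ ℕ) (i j : ℕ) :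
    s = Finsupp.single 0 i + Finsupp.single 1 j ↔ s 0 = i ∧ s 1 = j := by
  constructor
  · rintro rfl
    simp
  · rintro ⟨rfl, rfl⟩
    ext i
    fin_cases i <;> simp

lemma coeff_coeff_diagNumer {N : ℕ} {A : MvPolynomial (Fin 2) k} (hN : A.degreeOf 0 ≤ N)
    (m i : ℕ) : ((diagNumer N A).coeff m).coeff i =
      if i ≤ N ∧ N ≤ m + i then A.coeff (Finsupp.single 0 i + Finsupp.single 1 (m + i - N))
      else 0 := by
  have hterm : ∀ s ∈ A.support,
      ((C (C (A.coeff s) * X ^ s 0) * X ^ (s 1 + N - s 0) : k[X][X]).coeff m).coeff i =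
        if s = Finsupp.single 0 i + Finsupp.single 1 (m + i - N) ∧ (i ≤ N ∧ N ≤ m + i)
        then A.coeff s else 0 := by
    intro s hs
    have hs0 : s 0 ≤ N := (MvPolynomial.le_degreeOf_of_mem_support 0 hs).trans hN
    rw [coeff_C_mul_X_pow, apply_ite (Polynomial.coeff · i), coeff_C_mul_X_pow, coeff_zero,
      ← ite_and]
    refine if_congr ?_ rfl rfl
    rw [eq_single_add_single_iff]
    omega
  rw [diagNumer_eq_sum, finsetSum_coeff, finsetSum_coeff, Finset.sum_congr rfl hterm]
  simp only [ite_and, Finset.sum_ite_eq', MvPolynomial.mem_support_iff]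
  split_ifs with h1 h2 <;> simp_all

lemma natDegree_diagNumer_le {N M : ℕ} {A : MvPolynomial (Fin 2) k} (hM : A.degreeOf 1 ≤ M) :
    (diagNumer N A).natDegree ≤ N + M := by
  rw [diagNumer_eq_sum]
  refine natDegree_sum_le_of_forall_le _ _ fun s hs => (natDegree_C_mul_X_pow_le _ _).trans ?_
  have := (MvPolynomial.le_degreeOf_of_mem_support 1 hs).trans hM
  omega

lemma diagNumer_ne_zero {N : ℕ} {A : MvPolynomial (Fin 2) k} (hA : A ≠ 0)
    (hN : A.degreeOf 0 ≤ N) : diagNumer N A ≠ 0 := by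
  obtain ⟨s, hs⟩ := MvPolynomial.support_nonempty.2 hA
  have hs0 : s 0 ≤ N := (MvPolynomial.le_degreeOf_of_mem_support 0 hs).trans hN
  have hs' : s = Finsupp.single 0 (s 0) + Finsupp.single 1 (s 1 + N - s 0 + s 0 - N) := by
    rw [eq_single_add_single_iff]
    omega
  intro h
  have hcoeff := coeff_coeff_diagNumer hN (s 1 + N - s 0) (s 0)
  rw [h, if_pos (by omega), ← hs', coeff_zero, coeff_zero] at hcoeff
  exact MvPolynomial.mem_support_iff.1 hs hcoeff.symm

lemma coeff_top_diagNumer {N M : ℕ} {A : MvPolynomial (Fin 2) k} (hN : A.degreeOf 0 ≤ N)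
    (hM : A.degreeOf 1 ≤ M) :
    (diagNumer N A).coeff (N + M) = C (A.coeff (Finsupp.single 1 M)) := by
  ext i
  rw [coeff_coeff_diagNumer hN, coeff_C]
  rcases Nat.eq_zero_or_pos i with rfl | hi
  · simp
  · rw [if_neg hi.ne', ite_eq_right_iff]
    intro hiN
    by_contra hne
    have hle : N + M + i - N ≤ M := by
      simpa using (MvPolynomial.le_degreeOf_of_mem_support 1
        (MvPolynomial.mem_support_iff.2 hne)).trans hM
    omega

lemma pow_mul_pow_mul_pow {T : Type*} [CommMonoid T] (x y : T) {i N : ℕ} (hi : i ≤ N) (j : ℕ) :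
    x ^ i * y ^ j * y ^ N = (x * y) ^ i * y ^ (j + N - i) := by
  rw [mul_pow, mul_assoc, mul_assoc, ← pow_add, ← pow_add]
  congr 2
  omega

lemma map_mul_pow_eq_map_diagNumer {T : Type*} [CommRing T] {Θ : MvPolynomial (Fin 2) k →+* T}
    {Ξ : k[X][X] →+* T} (hC : ∀ a, Ξ (C (C a)) = Θ (MvPolynomial.C a))
    (h0 : Θ (MvPolynomial.X 0) * Ξ X = Ξ (C X)) (h1 : Θ (MvPolynomial.X 1) = Ξ X) {N : ℕ}
    {A : MvPolynomial (Fin 2) k} (hN : A.degreeOf 0 ≤ N) :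
    Θ A * Ξ X ^ N = Ξ (diagNumer N A) := by
  conv_lhs => rw [A.as_sum]
  rw [map_sum, diagNumer_eq_sum, map_sum, Finset.sum_mul]
  refine Finset.sum_congr rfl fun s hs => ?_
  have hs0 : s 0 ≤ N := (MvPolynomial.le_degreeOf_of_mem_support 0 hs).trans hN
  rw [MvPolynomial.monomial_eq, Finsupp.prod_fintype _ _ (by simp), Fin.prod_univ_two]
  simp only [map_mul, map_pow]
  rw [h1, mul_assoc, pow_mul_pow_mul_pow _ _ hs0, h0, hC, mul_assoc]

local notation "ι" => algebraMap k[X][X] (FractionRing k[X][X])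

lemma substDiag_mul_pow {A : MvPolynomial (Fin 2) k} {N : ℕ} (hN : A.degreeOf 0 ≤ N) :
    substDiag A * ι X ^ N = ι (diagNumer N A) := by
  have hX : ι X ≠ 0 := (map_ne_zero_iff _ (IsFractionRing.injective _ _)).2 X_ne_zero
  refine map_mul_pow_eq_map_diagNumer (Θ := (MvPolynomial.aeval _ : _ →ₐ[k] _).toRingHom)
    (fun a => ?_) ?_ ?_ hN
  · simp [IsScalarTower.algebraMap_apply k k[X][X] (FractionRing k[X][X])]
  · simp [hX]
  · simp

lemma one_div_mul_substDiag_div {A B : MvPolynomial (Fin 2) k} {N : ℕ} (hA : A.degreeOf 0 ≤ N)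
    (hB : B.degreeOf 0 ≤ N + 1) :
    1 / ι X * (substDiag A / substDiag B) = ι (diagNumer N A) / ι (diagNumer (N + 1) B) := by
  have hX : ι X ≠ 0 := (map_ne_zero_iff _ (IsFractionRing.injective _ _)).2 X_ne_zero
  rw [← substDiag_mul_pow hA, ← substDiag_mul_pow hB, pow_succ, div_mul_div_comm, one_mul,
    mul_comm (substDiag B), mul_assoc, mul_comm (substDiag A),
    mul_div_mul_left _ _ (pow_ne_zero _ hX)]

end DiagNumer

section ReducedForm

variable {k : Type*} [Field k]

lemma natDegree_overRatFunc (P : k[X][X]) : (overRatFunc P).natDegree = P.natDegree :=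
  natDegree_map_eq_of_injective (IsFractionRing.injective _ _) _

lemma overRatFunc_ne_zero {P : k[X][X]} (hP : P ≠ 0) : overRatFunc P ≠ 0 :=
  (Polynomial.map_ne_zero_iff (IsFractionRing.injective _ _)).2 hP

lemma overRatFunc_C_C_mul (a : k) (P : k[X][X]) :
    overRatFunc (C (C a) * P) = C (algebraMap k (RatFunc k) a) * overRatFunc P := by
  rw [overRatFunc, Polynomial.map_mul, map_C, overRatFunc,
    IsScalarTower.algebraMap_apply k k[X] (RatFunc k), algebraMap_eq]

lemma isRelPrime_of_irreducible_overRatFunc {P Q : k[X][X]} (hP : P ≠ 0)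
    (hQ : Irreducible (overRatFunc Q)) (hl : IsUnit Q.leadingCoeff)
    (hdeg : P.natDegree < Q.natDegree) : IsRelPrime P Q := by
  intro d hdP hdQ
  rcases hQ.dvd_iff.1 (Polynomial.map_dvd (algebraMap k[X] (RatFunc k)) hdQ) with hu | ha
  · have h0 : d.natDegree = 0 := by
      rw [← natDegree_overRatFunc]
      exact natDegree_eq_zero_of_isUnit hu
    obtain ⟨e, rfl⟩ := natDegree_eq_zero.1 h0
    exact (isUnit_of_dvd_unit ((C_dvd_iff_dvd_coeff _ _).1 hdQ _) hl).map C
  · have h0 : Q.natDegree = d.natDegree := by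
      rw [← natDegree_overRatFunc, ← natDegree_overRatFunc d]
      exact natDegree_eq_of_degree_eq (degree_eq_degree_of_associated ha)
    exact absurd (natDegree_le_of_dvd hdP hP) (by omega)

lemma IsReducedForm.exists_eq_C_mul {A B : MvPolynomial (Fin 2) k} {P Q P' Q' : k[X][X]}
    (h : IsReducedForm A B P Q) (h' : IsReducedForm A B P' Q') :
    ∃ a : k, a ≠ 0 ∧ P' = C (C a) * P ∧ Q' = C (C a) * Q := by
  obtain ⟨hQ, hrel, heq⟩ := h
  obtain ⟨hQ', hrel', heq'⟩ := h'
  have hinj := IsFractionRing.injective k[X][X] (FractionRing k[X][X])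
  have hmul : P' * Q = P * Q' := by
    rw [heq', div_eq_div_iff ((map_ne_zero_iff _ hinj).2 hQ') ((map_ne_zero_iff _ hinj).2 hQ),
      ← map_mul, ← map_mul] at heq
    exact hinj heq
  have hdvd : Q ∣ Q' := hrel.symm.dvd_of_dvd_mul_left ⟨P', by rw [← hmul, mul_comm]⟩
  have hdvd' : Q' ∣ Q := hrel'.symm.dvd_of_dvd_mul_left ⟨P, by rw [hmul, mul_comm]⟩
  obtain ⟨u, hu⟩ := associated_of_dvd_dvd hdvd hdvd'
  obtain ⟨v, hv, huv⟩ := Polynomial.isUnit_iff.1 u.isUnit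
  obtain ⟨a, ha, rfl⟩ := Polynomial.isUnit_iff.1 hv
  have hQeq : Q' = C (C a) * Q := by rw [← hu, ← huv, mul_comm]
  refine ⟨a, ha.ne_zero, mul_right_cancel₀ hQ ?_, hQeq⟩
  rw [hmul, hQeq]
  ring

/-- `B` has degrees at most `dx` in `x` and `dy` in `y`, and nonzero coefficients at `1` and `y^dy`.
Hence `y^dx B(t / y, y)` has degree `dx + dy` in `y` with a constant leading coefficient, and
`dx` of its roots tend to `0` with `t`. -/
structure IsRegularDenominator (dx dy : ℕ) (B : MvPolynomial (Fin 2) k) : Prop where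
  degreeOf_zero_le : B.degreeOf 0 ≤ dx
  degreeOf_one_le : B.degreeOf 1 ≤ dy
  coeff_zero_ne_zero : B.coeff 0 ≠ 0
  coeff_top_ne_zero : B.coeff (Finsupp.single 1 dy) ≠ 0

namespace IsRegularDenominator

variable {dx dy : ℕ} {B : MvPolynomial (Fin 2) k}

lemma natDegree_diagNumer (hB : IsRegularDenominator dx dy B) :
    (diagNumer dx B).natDegree = dx + dy := by
  refine natDegree_eq_of_le_of_coeff_ne_zero (natDegree_diagNumer_le hB.degreeOf_one_le) ?_
  rw [coeff_top_diagNumer hB.degreeOf_zero_le hB.degreeOf_one_le]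
  exact C_ne_zero.2 hB.coeff_top_ne_zero

lemma isUnit_leadingCoeff (hB : IsRegularDenominator dx dy B) :
    IsUnit (diagNumer dx B).leadingCoeff := by
  rw [leadingCoeff, hB.natDegree_diagNumer,
    coeff_top_diagNumer hB.degreeOf_zero_le hB.degreeOf_one_le]
  exact (isUnit_iff_ne_zero.2 hB.coeff_top_ne_zero).map C

lemma coeff_coeff_zero_of_lt (hB : IsRegularDenominator dx dy B) {m : ℕ} (hm : m < dx) :
    ((diagNumer dx B).coeff m).coeff 0 = 0 := by
  rw [coeff_coeff_diagNumer hB.degreeOf_zero_le, if_neg (by omega)]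

lemma coeff_coeff_zero_ne_zero (hB : IsRegularDenominator dx dy B) :
    ((diagNumer dx B).coeff dx).coeff 0 ≠ 0 := by
  rw [coeff_coeff_diagNumer hB.degreeOf_zero_le, if_pos (by omega)]
  simpa using hB.coeff_zero_ne_zero

lemma diagNumer_ne_zero (hB : IsRegularDenominator dx dy B) : diagNumer dx B ≠ 0 :=
  leadingCoeff_ne_zero.1 hB.isUnit_leadingCoeff.ne_zero

lemma isReducedForm {N M : ℕ} {A : MvPolynomial (Fin 2) k}
    (hB : IsRegularDenominator (N + 1) (M + 1) B)
    (hQ : Irreducible (overRatFunc (diagNumer (N + 1) B))) (hA : A ≠ 0) (hN : A.degreeOf 0 ≤ N)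
    (hM : A.degreeOf 1 ≤ M) :
    IsReducedForm A B (diagNumer N A) (diagNumer (N + 1) B) := by
  refine ⟨hB.diagNumer_ne_zero,
    isRelPrime_of_irreducible_overRatFunc (AlgDiag.diagNumer_ne_zero hA hN) hQ
      hB.isUnit_leadingCoeff ?_,
    one_div_mul_substDiag_div hN hB.degreeOf_zero_le⟩
  have := natDegree_diagNumer_le (N := N) hM
  rw [hB.natDegree_diagNumer]
  omega

end IsRegularDenominator

end ReducedForm

section RatFuncFractionRing

variable (R : Type*) [CommRing R] [IsDomain R]

/-- The embedding of `R[t]` in `Frac(R)(t)`, its field of fractions. -/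
def toRatFunc : R[X] →+* RatFunc (FractionRing R) :=
  (algebraMap (FractionRing R)[X] (RatFunc (FractionRing R))).comp
    (mapRingHom (algebraMap R (FractionRing R)))

lemma toRatFunc_injective : Function.Injective (toRatFunc R) :=
  (IsFractionRing.injective (FractionRing R)[X] _).comp
    (Polynomial.map_injective _ (IsFractionRing.injective R _))

variable {R}

attribute [local instance] Polynomial.algebra

lemma ratFunc_ringHom_ext {E : Type*} [CommRing E] {f g : RatFunc (FractionRing R) →+* E}
    (h : f.comp (toRatFunc R) = g.comp (toRatFunc R)) : f = g := by
  refine IsLocalization.ringHom_ext (nonZeroDivisors (FractionRing R)[X]) ?_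
  have := Polynomial.isLocalization (nonZeroDivisors R) (FractionRing R)
  exact IsLocalization.ringHom_ext ((nonZeroDivisors R).map C) h

lemma exists_comp_toRatFunc_eq {E : Type*} [Field E] {f : R[X] →+* E}
    (hf : Function.Injective f) :
    ∃ θ : RatFunc (FractionRing R) →+* E, θ.comp (toRatFunc R) = f := by
  have := Polynomial.isLocalization (nonZeroDivisors R) (FractionRing R)
  have hunit (s : (nonZeroDivisors R).map (C : R →+* R[X])) : IsUnit (f s) := by
    obtain ⟨_, r, hr, rfl⟩ := s
    rw [isUnit_iff_ne_zero]
    exact (map_ne_zero_iff f hf).2 (C_ne_zero.2 (nonZeroDivisors.ne_zero hr))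
  have hinj : Function.Injective
      (IsLocalization.lift hunit : (FractionRing R)[X] →+* E) := by
    rw [IsLocalization.lift_injective_iff]
    intro x y
    rw [hf.eq_iff]
    exact (Polynomial.map_injective _ (IsFractionRing.injective R (FractionRing R))).eq_iff
  refine ⟨IsFractionRing.lift hinj, RingHom.ext fun p => ?_⟩
  rw [toRatFunc, RingHom.comp_apply, RingHom.comp_apply, IsFractionRing.lift_algebraMap]
  exact IsLocalization.lift_eq hunit p

end RatFuncFractionRing

section UniversalRoots

variable {K ι : Type*} [Field K] [Fintype ι]

/-- The polynomial with leading coefficient `a` whose roots are independent indeterminates. -/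
def universalSplit (ι : Type*) [Fintype ι] (a : K) : (MvPolynomial ι K)[X] :=
  C (MvPolynomial.C a) * ∏ i, (X - C (MvPolynomial.X i))

lemma map_universalSplit {S : Type*} [CommRing S] (f : MvPolynomial ι K →+* S) (a : K) :
    (universalSplit ι a).map f =
      C (f (MvPolynomial.C a)) * ∏ i, (X - C (f (MvPolynomial.X i))) := by
  simp only [universalSplit, Polynomial.map_mul, map_C, Polynomial.map_prod, Polynomial.map_sub,
    map_X]

lemma natDegree_universalSplit_le (a : K) :
    (universalSplit ι a).natDegree ≤ Fintype.card ι := by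
  refine (natDegree_C_mul_le _ _).trans ?_
  rw [natDegree_prod_of_monic _ _ fun i _ => monic_X_sub_C _]
  simp

lemma map_rename_universalSplit (a : K) (σ : Equiv.Perm ι) :
    (universalSplit ι a).map (MvPolynomial.rename σ : _ →ₐ[K] _).toRingHom =
      universalSplit ι a := by
  rw [map_universalSplit, universalSplit,
    ← Equiv.prod_comp σ fun i => (X - C (MvPolynomial.X i) : (MvPolynomial ι K)[X])]
  simp

lemma map_rename_universalSplit_sub_map_C (Q : K[X]) (a : K) (σ : Equiv.Perm ι) :
    (universalSplit ι a - Q.map MvPolynomial.C).map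
        (MvPolynomial.rename σ : _ →ₐ[K] _).toRingHom =
      universalSplit ι a - Q.map MvPolynomial.C := by
  rw [Polynomial.map_sub, map_rename_universalSplit, Polynomial.map_map]
  congr 2
  ext x
  simp

lemma map_aeval_universalSplit_sub_map_C {L : Type*} [CommRing L] [Algebra K L] {Q : K[X]} {a : K}
    {y : ι → L} (hy : Q.map (algebraMap K L) = C (algebraMap K L a) * ∏ i, (X - C (y i))) :
    (universalSplit ι a - Q.map MvPolynomial.C).map
      (MvPolynomial.aeval y : _ →ₐ[K] L).toRingHom = 0 := by
  have hC : (MvPolynomial.aeval y : _ →ₐ[K] L).toRingHom.comp MvPolynomial.C =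
      algebraMap K L := by
    ext x
    simp
  rw [Polynomial.map_sub, map_universalSplit, Polynomial.map_map, hC, hy, sub_eq_zero]
  simp

lemma exists_hasSymmetricRoots_of_map_eq {R : Type*} [CommRing R] [IsDomain R] {Q : R[X][X]}
    {f : R[X] →+* MvPolynomial ι K} (hf : Function.Injective f) {a : K} (ha : a ≠ 0)
    (hQ : Q.map f = universalSplit ι a)
    (hσ : ∀ σ : Equiv.Perm ι, (MvPolynomial.rename σ : _ →ₐ[K] _).toRingHom.comp f = f) :
    ∃ (θ : RatFunc (FractionRing R) →+* FractionRing (MvPolynomial ι K))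
      (l : FractionRing (MvPolynomial ι K)) (Y : ι → FractionRing (MvPolynomial ι K)),
      HasSymmetricRoots θ (Q.map (toRatFunc R)) l Y := by
  let j := algebraMap (MvPolynomial ι K) (FractionRing (MvPolynomial ι K))
  have hj : Function.Injective j := IsFractionRing.injective _ _
  obtain ⟨θ, hθ⟩ := exists_comp_toRatFunc_eq (f := j.comp f) (hj.comp hf)
  refine ⟨θ, j (MvPolynomial.C a), fun i => j (MvPolynomial.X i), ⟨⟨?_, ?_⟩, ?_, fun σ => ?_⟩⟩
  · rwa [map_ne_zero_iff j hj, Ne, MvPolynomial.C_eq_zero]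
  · rw [Polynomial.map_map, hθ, ← Polynomial.map_map, hQ, map_universalSplit]
  · exact hj.comp MvPolynomial.X_injective
  · have hinj : Function.Injective
        (j.comp (MvPolynomial.rename σ : _ →ₐ[K] _).toRingHom) :=
      hj.comp (MvPolynomial.rename_injective σ σ.injective)
    have hlift : (IsFractionRing.lift hinj : FractionRing (MvPolynomial ι K) →+* _).comp j =
        j.comp (MvPolynomial.rename σ : _ →ₐ[K] _).toRingHom :=
      IsLocalization.lift_comp _
    refine ⟨IsFractionRing.lift hinj, ratFunc_ringHom_ext ?_, fun i => ?_⟩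
    · rw [RingHom.comp_assoc, hθ, ← RingHom.comp_assoc, hlift, RingHom.comp_assoc, hσ]
    · rw [← RingHom.comp_apply, hlift]
      simp

end UniversalRoots

section DiagDenom

variable {dx dy : ℕ} {S : Type*} [CommRing S]

/-- `y^dx B(t / y, y)`, where `β (i, j)` is the coefficient of `x^i y^j` in `B`. -/
def diagDenom (t : S) (β : Fin (dx + 1) × Fin (dy + 1) → S) : S[X] :=
  ∑ i : Fin (dx + 1), ∑ j : Fin (dy + 1),
    C (β (i, j) * t ^ (i : ℕ)) * X ^ ((j : ℕ) + dx - i)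

lemma map_diagDenom {T : Type*} [CommRing T] (f : S →+* T) (t : S)
    (β : Fin (dx + 1) × Fin (dy + 1) → S) :
    (diagDenom t β).map f = diagDenom (f t) (f ∘ β) := by
  simp only [diagDenom, Polynomial.map_sum, Polynomial.map_mul, map_C, Polynomial.map_pow, map_X,
    map_mul, map_pow, Function.comp_apply]

lemma diagDenom_add (t : S) (β γ : Fin (dx + 1) × Fin (dy + 1) → S) :
    diagDenom t (β + γ) = diagDenom t β + diagDenom t γ := by
  simp only [diagDenom, Pi.add_apply, add_mul, C_add, Finset.sum_add_distrib]

variable (dx dy) in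
/-- When `t` is invertible, a choice of coefficients supported on the hook `i = 0` or `j = 0` for
which `diagDenom` is a given polynomial `D` of degree at most `dx + dy`; `t'` is the inverse
of `t`. -/
def hookCoeff (t' : S) (D : S[X]) (p : Fin (dx + 1) × Fin (dy + 1)) : S :=
  if p.1 = 0 ∨ p.2 = 0 then t' ^ (p.1 : ℕ) * D.coeff (p.2 + dx - p.1) else 0

lemma comp_hookCoeff {T : Type*} [CommRing T] (f : S →+* T) (t' : S) (D : S[X]) :
    f ∘ hookCoeff dx dy t' D = hookCoeff dx dy (f t') (D.map f) := by
  ext p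
  simp only [hookCoeff, Function.comp_apply, apply_ite f, map_mul, map_pow, coeff_map, map_zero]

lemma hookCoeff_zero (t' : S) : hookCoeff dx dy t' 0 = 0 := by
  ext p
  simp [hookCoeff]

lemma sum_hook {G : Type*} [AddCommMonoid G] (f : ℕ → G) :
    ∑ i : Fin (dx + 1), ∑ j : Fin (dy + 1), (if i = 0 ∨ j = 0 then f (j + dx - i) else 0) =
      ∑ m ∈ Finset.range (dx + dy + 1), f m := by
  have hrow : ∑ j : Fin (dy + 1), (if (0 : Fin (dx + 1)) = 0 ∨ j = 0 then
      f (j + dx - (0 : Fin (dx + 1))) else 0) = ∑ j ∈ Finset.range (dy + 1), f (dx + j) := by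
    rw [← Fin.sum_univ_eq_sum_range (fun j => f (dx + j))]
    simp [add_comm]
  have hcolumn (i : Fin dx) : ∑ j : Fin (dy + 1), (if i.succ = 0 ∨ j = 0 then
      f (j + dx - i.succ) else 0) = f (dx - 1 - i) := by
    rw [Fintype.sum_eq_single 0 fun j hj => by simp [hj]]
    simp [Nat.sub_sub, add_comm]
  rw [Fin.sum_univ_succ, hrow, Fintype.sum_congr _ _ hcolumn,
    Fin.sum_univ_eq_sum_range (fun i => f (dx - 1 - i)), Finset.sum_range_reflect, add_comm,
    add_assoc dx dy 1, Finset.sum_range_add f]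

lemma diagDenom_hookCoeff {t t' : S} (h : t * t' = 1) {D : S[X]} (hD : D.natDegree ≤ dx + dy) :
    diagDenom t (hookCoeff dx dy t' D) = D := by
  have hterm (i : Fin (dx + 1)) (j : Fin (dy + 1)) :
      C (hookCoeff dx dy t' D (i, j) * t ^ (i : ℕ)) * X ^ ((j : ℕ) + dx - i) =
        if i = 0 ∨ j = 0 then C (D.coeff (j + dx - i)) * X ^ ((j : ℕ) + dx - i) else 0 := by
    rw [hookCoeff]
    split_ifs
    · rw [mul_right_comm, ← mul_pow, mul_comm t', h, one_pow, one_mul]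
    · rw [zero_mul, C_0, zero_mul]
  simp only [diagDenom, hterm]
  rw [sum_hook fun m => C (D.coeff m) * X ^ m,
    ← as_sum_range_C_mul_X_pow' D (Nat.lt_succ_of_le hD)]

end DiagDenom

section UniversalCoefficients

variable {K : Type*} [Field K] {dx dy : ℕ}

lemma exists_eq_C_mul_prod_of_splits {f : K[X]} (hf : f.Splits) {n : ℕ} (hn : f.natDegree = n) :
    ∃ y : Fin n → K, f = C f.leadingCoeff * ∏ i, (X - C (y i)) := by
  have hlength : f.roots.toList.length = n := by
    rw [Multiset.length_toList, ← hf.natDegree_eq_card_roots, hn]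
  subst hlength
  refine ⟨f.roots.toList.get, ?_⟩
  have hprod : ∏ i, (X - C (f.roots.toList.get i)) = (f.roots.map fun a => X - C a).prod := by
    rw [← Multiset.coe_toList f.roots, Multiset.map_coe, Multiset.prod_coe,
      ← List.prod_ofFn, Multiset.coe_toList]
    exact congrArg List.prod (List.ext_get (by simp) (by simp))
  rw [hprod, ← hf.eq_prod_roots]

/-- The difference between the universal split polynomial and the given one is symmetric in the
indeterminates and vanishes when these are specialized to the actual roots; the coefficients `β`
are obtained by adding it to `b` along the hook. -/
lemma exists_diagDenom_eq_universalSplit {t : K} (ht : t ≠ 0)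
    {b : Fin (dx + 1) × Fin (dy + 1) → K} (hdeg : (diagDenom t b).natDegree = dx + dy) :
    ∃ β : Fin (dx + 1) × Fin (dy + 1) → MvPolynomial (Fin (dx + dy)) K,
      diagDenom (MvPolynomial.C t) β =
        universalSplit (Fin (dx + dy)) (diagDenom t b).leadingCoeff ∧
      (∀ σ : Equiv.Perm (Fin (dx + dy)), MvPolynomial.rename σ ∘ β = β) ∧
      ∃ spec : MvPolynomial (Fin (dx + dy)) K →ₐ[K] AlgebraicClosure K,
        spec ∘ β = algebraMap K _ ∘ b := by
  set Q := diagDenom t b with hQ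
  have ht' : (MvPolynomial.C t * MvPolynomial.C t⁻¹ : MvPolynomial (Fin (dx + dy)) K) = 1 := by
    rw [← MvPolynomial.C_mul, mul_inv_cancel₀ ht, MvPolynomial.C_1]
  set D := universalSplit (Fin (dx + dy)) Q.leadingCoeff - Q.map MvPolynomial.C with hD
  have hDdeg : D.natDegree ≤ dx + dy := by
    refine (natDegree_sub_le _ _).trans (max_le ?_ (natDegree_map_le.trans hdeg.le))
    simpa using natDegree_universalSplit_le (ι := Fin (dx + dy)) Q.leadingCoeff
  refine ⟨MvPolynomial.C ∘ b + hookCoeff dx dy (MvPolynomial.C t⁻¹) D, ?_, fun σ => ?_, ?_⟩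
  · rw [diagDenom_add, diagDenom_hookCoeff ht' hDdeg, ← map_diagDenom, ← hQ, hD]
    ring
  · have hrename : (MvPolynomial.rename σ : _ →ₐ[K] _).toRingHom ∘
        (MvPolynomial.C ∘ b + hookCoeff dx dy (MvPolynomial.C t⁻¹) D) =
          MvPolynomial.C ∘ b + hookCoeff dx dy (MvPolynomial.C t⁻¹) D := by
      rw [map_comp_add, comp_hookCoeff, map_rename_universalSplit_sub_map_C, ← hD]
      simp [Function.comp_def]
    exact hrename
  · obtain ⟨y, hy⟩ := exists_eq_C_mul_prod_of_splits
      (IsAlgClosed.splits (Q.map (algebraMap K (AlgebraicClosure K))))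
      ((natDegree_map _).trans hdeg)
    rw [leadingCoeff_map] at hy
    have hspec : (MvPolynomial.aeval y : _ →ₐ[K] AlgebraicClosure K).toRingHom ∘
        (MvPolynomial.C ∘ b + hookCoeff dx dy (MvPolynomial.C t⁻¹) D) = algebraMap K _ ∘ b := by
      rw [map_comp_add, comp_hookCoeff, map_aeval_universalSplit_sub_map_C hy, hookCoeff_zero,
        add_zero]
      ext p
      simp
    exact ⟨MvPolynomial.aeval y, hspec⟩

end UniversalCoefficients

section Generic

variable (dx dy : ℕ)

/-- `y^dx B(t / y, y)` for the generic `B`, with coefficients in `ℚ[b_{i,j}][t]`. -/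
def universalDenom : (MvPolynomial (Fin (dx + 1) × Fin (dy + 1)) ℚ)[X][X] :=
  diagDenom X fun p => C (MvPolynomial.X p)

lemma overRatFunc_diagNumer_genericB : overRatFunc (diagNumer dx (genericB dx dy)) =
    (universalDenom dx dy).map (toRatFunc _) := by
  rw [toRatFunc, ← Polynomial.map_map]
  refine congrArg overRatFunc ?_
  simp only [genericB, map_sum, diagNumer_C_mul_X_pow, universalDenom, map_diagDenom]
  simp [diagDenom]

lemma genericB_eq_sum_monomial : genericB dx dy =
    ∑ i : Fin (dx + 1), ∑ j : Fin (dy + 1),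
      MvPolynomial.monomial (Finsupp.single 0 (i : ℕ) + Finsupp.single 1 (j : ℕ))
        (algebraMap (MvPolynomial (Fin (dx + 1) × Fin (dy + 1)) ℚ) (GenericField dx dy)
          (MvPolynomial.X (i, j))) := by
  simp only [genericB, C_mul_X_pow_mul_X_pow_eq_monomial]

lemma coeff_genericB_ne_zero (i : Fin (dx + 1)) (j : Fin (dy + 1)) :
    (genericB dx dy).coeff (Finsupp.single 0 (i : ℕ) + Finsupp.single 1 (j : ℕ)) ≠ 0 := by
  have hcoeff : (genericB dx dy).coeff (Finsupp.single 0 (i : ℕ) + Finsupp.single 1 (j : ℕ)) =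
      algebraMap (MvPolynomial (Fin (dx + 1) × Fin (dy + 1)) ℚ) (GenericField dx dy)
        (MvPolynomial.X (i, j)) := by
    simp only [genericB_eq_sum_monomial, MvPolynomial.coeff_sum, MvPolynomial.coeff_monomial,
      eq_single_add_single_iff]
    rw [Fintype.sum_eq_single i, Fintype.sum_eq_single j]
    · simp
    · intro j' hj'
      simp [Fin.val_inj, hj']
    · intro i' hi'
      simp [Fin.val_inj, hi']
  rw [hcoeff]
  exact (map_ne_zero_iff _ (IsFractionRing.injective _ _)).2 (MvPolynomial.X_ne_zero _)

lemma degreeOf_genericB_le (n : Fin 2) {d : ℕ}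
    (h : ∀ (i : Fin (dx + 1)) (j : Fin (dy + 1)),
      (Finsupp.single 0 (i : ℕ) + Finsupp.single 1 (j : ℕ) : Fin 2 →₀ ℕ) n ≤ d) :
    (genericB dx dy).degreeOf n ≤ d := by
  rw [genericB_eq_sum_monomial]
  refine (MvPolynomial.degreeOf_sum_le n _ _).trans (Finset.sup_le fun i _ => ?_)
  refine (MvPolynomial.degreeOf_sum_le n _ _).trans (Finset.sup_le fun j _ => ?_)
  rw [MvPolynomial.degreeOf_monomial_eq _ _
    ((map_ne_zero_iff _ (IsFractionRing.injective _ _)).2 (MvPolynomial.X_ne_zero _))]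
  exact h i j

lemma isRegularDenominator_genericB : IsRegularDenominator dx dy (genericB dx dy) where
  degreeOf_zero_le := degreeOf_genericB_le dx dy 0 fun i j => by simpa using i.is_le
  degreeOf_one_le := degreeOf_genericB_le dx dy 1 fun i j => by simpa using j.is_le
  coeff_zero_ne_zero := by simpa using coeff_genericB_ne_zero dx dy 0 0
  coeff_top_ne_zero := by simpa using coeff_genericB_ne_zero dx dy 0 (Fin.last dy)

local notation "𝕂" => RatFunc (GenericField dx dy)

local notation "𝕂bar" => AlgebraicClosure (RatFunc (GenericField dx dy))

theorem exists_hasSymmetricRoots_genericB :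
    ∃ (θ : 𝕂 →+* FractionRing (MvPolynomial (Fin (dx + dy)) 𝕂))
      (l : FractionRing (MvPolynomial (Fin (dx + dy)) 𝕂))
      (Y : Fin (dx + dy) → FractionRing (MvPolynomial (Fin (dx + dy)) 𝕂)),
      HasSymmetricRoots θ (overRatFunc (diagNumer dx (genericB dx dy))) l Y := by
  have htoRatFunc : toRatFunc (MvPolynomial (Fin (dx + 1) × Fin (dy + 1)) ℚ) X = RatFunc.X := by
    simp [toRatFunc]
  set b : Fin (dx + 1) × Fin (dy + 1) → 𝕂 := fun p => toRatFunc _ (C (MvPolynomial.X p))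
  have hQ : overRatFunc (diagNumer dx (genericB dx dy)) = diagDenom RatFunc.X b := by
    rw [overRatFunc_diagNumer_genericB, universalDenom, map_diagDenom, htoRatFunc]
    rfl
  have hdeg : (diagDenom RatFunc.X b).natDegree = dx + dy := by
    rw [← hQ, natDegree_overRatFunc, (isRegularDenominator_genericB dx dy).natDegree_diagNumer]
  obtain ⟨β, hβ, hσ, spec, hspec⟩ := exists_diagDenom_eq_universalSplit RatFunc.X_ne_zero hdeg
  let f : (MvPolynomial (Fin (dx + 1) × Fin (dy + 1)) ℚ)[X] →+* MvPolynomial (Fin (dx + dy)) 𝕂 :=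
    eval₂RingHom (MvPolynomial.eval₂Hom (algebraMap ℚ _) β) (MvPolynomial.C RatFunc.X)
  have hf : Function.Injective f := by
    have hcomp : spec.toRingHom.comp f = (algebraMap 𝕂 𝕂bar).comp (toRatFunc _) := by
      refine Polynomial.ringHom_ext'
        (MvPolynomial.ringHom_ext' (Subsingleton.elim _ _) fun p => ?_) ?_
      · simpa [f] using congrFun hspec p
      · simp [f, htoRatFunc]
    have hinj : Function.Injective (spec.toRingHom.comp f) := by
      rw [hcomp]
      exact (algebraMap 𝕂 𝕂bar).injective.comp (toRatFunc_injective _)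
    exact Function.Injective.of_comp hinj
  rw [overRatFunc_diagNumer_genericB]
  refine exists_hasSymmetricRoots_of_map_eq hf (a := (diagDenom RatFunc.X b).leadingCoeff)
    ?_ ?_ fun σ => ?_
  · rw [Polynomial.leadingCoeff_ne_zero, ← hQ]
    exact overRatFunc_ne_zero (isRegularDenominator_genericB dx dy).diagNumer_ne_zero
  · rw [universalDenom, map_diagDenom, ← hβ]
    congr 1
    · simp [f]
    · ext1 p
      simp [f]
  · refine Polynomial.ringHom_ext'
      (MvPolynomial.ringHom_ext' (Subsingleton.elim _ _) fun p => ?_) ?_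
    · simpa [f] using congrFun (hσ σ) p
    · simp [f]

end Generic

section Distinguished

variable {R : Type*} [CommRing R] {I : Ideal R} [IsAdicComplete I R] {W : R[X]}

lemma coe_dvd_coe_iff_of_isDistinguishedAt (hW : W.IsDistinguishedAt I) {p : R[X]} :
    (W : PowerSeries R) ∣ p ↔ W ∣ p := by
  refine ⟨fun h => ?_, fun ⟨q, hq⟩ => ⟨q, by rw [hq, Polynomial.coe_mul]⟩⟩
  rw [← Ideal.mem_span_singleton, ← Ideal.Quotient.eq_zero_iff_mem] at h ⊢
  exact hW.algEquivQuotient.injective ((map_zero hW.algEquivQuotient).symm ▸ h)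

lemma isCoprime_of_isDistinguishedAt (hW : W.IsDistinguishedAt I) {H : R[X]}
    (hH : IsUnit (H.coeff 0)) : IsCoprime W H := by
  have hunit : IsUnit (H : PowerSeries R) :=
    PowerSeries.isUnit_iff_constantCoeff.2 (by rwa [Polynomial.constantCoeff_coe])
  have hmk : hW.algEquivQuotient (Ideal.Quotient.mk _ H) =
      Ideal.Quotient.mk (Ideal.span {(W : PowerSeries R)}) H := rfl
  have hquot : IsUnit (Ideal.Quotient.mk (Ideal.span {W}) H) := by
    rw [← MulEquiv.isUnit_map hW.algEquivQuotient, hmk]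
    exact hunit.map _
  obtain ⟨b, hb⟩ := hquot.exists_left_inv
  obtain ⟨b, rfl⟩ := Ideal.Quotient.mk_surjective b
  rw [← map_mul, ← map_one (Ideal.Quotient.mk (Ideal.span {W})), Ideal.Quotient.eq,
    Ideal.mem_span_singleton] at hb
  obtain ⟨a, ha⟩ := hb
  exact ⟨-a, b, by linear_combination ha⟩

end Distinguished

lemma exists_eq_mul_add_mul_of_isCoprime {R : Type*} [CommRing R] [Nontrivial R] {W H : R[X]}
    (hW : W.Monic) (h : IsCoprime W H) (P : R[X]) :
    ∃ U V : R[X], U.degree < W.degree ∧ P = U * H + W * V := by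
  obtain ⟨a, b, hab⟩ := h
  refine ⟨(P * b) %ₘ W, P * a + (P * b) /ₘ W * H, degree_modByMonic_lt _ hW, ?_⟩
  linear_combination -P * hab - H * modByMonic_add_div (P * b) W

lemma exists_isDistinguishedAt_mul {R : Type*} [CommRing R] [IsLocalRing R]
    [IsAdicComplete (IsLocalRing.maximalIdeal R) R] {Q : R[X]} {c : ℕ}
    (hlow : ∀ i < c, ¬IsUnit (Q.coeff i)) (hc : IsUnit (Q.coeff c)) :
    ∃ W H : R[X], W.IsDistinguishedAt (IsLocalRing.maximalIdeal R) ∧ W.natDegree = c ∧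
      IsUnit (H.coeff 0) ∧ Q = W * H := by
  have hcoeff (i : ℕ) : PowerSeries.coeff i
      ((Q : PowerSeries R).map (IsLocalRing.residue R)) = IsLocalRing.residue R (Q.coeff i) := by
    rw [PowerSeries.coeff_map, Polynomial.coeff_coe]
  have horder : ((Q : PowerSeries R).map (IsLocalRing.residue R)).order = c := by
    rw [PowerSeries.order_eq_nat]
    simp only [hcoeff, IsLocalRing.residue_eq_zero_iff, IsLocalRing.residue_ne_zero_iff_isUnit,
      IsLocalRing.mem_maximalIdeal, mem_nonunits_iff]
    exact ⟨hc, hlow⟩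
  have hne : (Q : PowerSeries R).map (IsLocalRing.residue R) ≠ 0 := fun h => by
    rw [h, PowerSeries.order_zero] at horder
    exact ENat.top_ne_natCast _ horder
  obtain ⟨W, h, hWh⟩ := PowerSeries.exists_isWeierstrassFactorization hne
  have hdeg : W.natDegree = c := by
    rw [hWh.natDegree_eq_toNat_order_map, horder, ENat.toNat_natCast]
  obtain ⟨H, rfl⟩ :=
    (coe_dvd_coe_iff_of_isDistinguishedAt hWh.isDistinguishedAt).1 ⟨h, hWh.eq_mul⟩
  refine ⟨W, H, hWh.isDistinguishedAt, hdeg, ?_, rfl⟩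
  have hmap : W.map (IsLocalRing.residue R) = X ^ W.natDegree :=
    hWh.isDistinguishedAt.map_eq_X_pow
  rwa [← IsLocalRing.residue_ne_zero_iff_isUnit, ← coeff_map, Polynomial.map_mul, hmap, hdeg,
    coeff_X_pow_mul', if_pos le_rfl, Nat.sub_self, coeff_map,
    IsLocalRing.residue_ne_zero_iff_isUnit] at hc

section SplitsWithRoots

variable {R E ι κ : Type*} [CommRing R] [Field E] [Fintype ι] [Fintype κ] {θ : R →+* E}

lemma exists_splitsWithRoots_of_isAlgClosed [IsAlgClosed E] (hθ : Function.Injective θ) {P : R[X]}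
    (hP : P ≠ 0) :
    ∃ y : Fin P.natDegree → E, SplitsWithRoots θ P (P.map θ).leadingCoeff y := by
  obtain ⟨y, hy⟩ := exists_eq_C_mul_prod_of_splits (IsAlgClosed.splits (P.map θ))
    (natDegree_map_eq_of_injective hθ P)
  exact ⟨y, leadingCoeff_ne_zero.2 ((Polynomial.map_ne_zero_iff hθ).2 hP), hy⟩

namespace SplitsWithRoots

variable {W H U V : R[X]} {a b : E} {r : ι → E} {s : κ → E}

lemma mul (hW : SplitsWithRoots θ W a r) (hH : SplitsWithRoots θ H b s) :
    SplitsWithRoots θ (W * H) (a * b) (Sum.elim r s) where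
  leadingCoeff_ne_zero := mul_ne_zero hW.leadingCoeff_ne_zero hH.leadingCoeff_ne_zero
  map_eq := by
    rw [Polynomial.map_mul, hW.map_eq, hH.map_eq, Fintype.prod_sum_type, Polynomial.C_mul]
    simp only [Sum.elim_inl, Sum.elim_inr]
    ring

lemma injective_of_separable (h : SplitsWithRoots θ W a r) (hsep : (W.map θ).Separable) :
    Function.Injective r :=
  (h.map_eq ▸ hsep).of_mul_right.injective_of_prod_X_sub_C

lemma sum_simpleResidue_mul (h : SplitsWithRoots θ W a r) (hr : Function.Injective r)
    (hH : ∀ i, ¬(H.map θ).IsRoot (r i)) (hU : U.degree < Fintype.card ι) :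
    ∑ i, simpleResidue ((U * H + W * V).map θ) ((W * H).map θ) (r i) =
      θ (U.coeff (Fintype.card ι - 1)) / a := by
  rw [← coeff_map, ← h.sum_simpleResidue hr (degree_map_le.trans_lt hU)]
  refine Finset.sum_congr rfl fun i _ => ?_
  have hnumer : ((U * H + W * V).map θ).eval (r i) =
      (U.map θ).eval (r i) * (H.map θ).eval (r i) := by
    rw [Polynomial.map_add, Polynomial.map_mul, Polynomial.map_mul, eval_add, eval_mul, eval_mul,
      (h.isRoot i).eq_zero, zero_mul, add_zero]
  have hdenom : (derivative ((W * H).map θ)).eval (r i) =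
      (derivative (W.map θ)).eval (r i) * (H.map θ).eval (r i) := by
    rw [Polynomial.map_mul, derivative_mul, eval_add, eval_mul, eval_mul, (h.isRoot i).eq_zero,
      zero_mul, add_zero]
  rw [simpleResidue, simpleResidue, hnumer, hdenom, mul_div_mul_right _ _ (hH i)]

end SplitsWithRoots

end SplitsWithRoots

section SmallBranches

variable {k : Type*} [Field k]

local notation "Ω" => AlgebraicClosure (LaurentSeries k)

lemma algebraMap_powerSeries_injective : Function.Injective (algebraMap (PowerSeries k) Ω) := by
  rw [IsScalarTower.algebraMap_eq (PowerSeries k) (LaurentSeries k) Ω]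
  exact (algebraMap (LaurentSeries k) Ω).injective.comp (IsFractionRing.injective _ _)

instance isAdicComplete_maximalIdeal_powerSeries :
    IsAdicComplete (IsLocalRing.maximalIdeal (PowerSeries k)) (PowerSeries k) := by
  rw [PowerSeries.maximalIdeal_eq_span_X]
  infer_instance

lemma isUnit_of_isIntegral_of_mul_eq_one {x : Ω} (hx : IsIntegral (PowerSeries k) x)
    {a : PowerSeries k} (h : algebraMap (PowerSeries k) Ω a * x = 1) : IsUnit a := by
  have ha : algebraMap (PowerSeries k) (LaurentSeries k) a ≠ 0 := by
    intro ha
    rw [IsScalarTower.algebraMap_apply (PowerSeries k) (LaurentSeries k) Ω, ha, map_zero,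
      zero_mul] at h
    exact zero_ne_one h
  have hx' : x = algebraMap (LaurentSeries k) Ω
      (algebraMap (PowerSeries k) (LaurentSeries k) a)⁻¹ := by
    rw [map_inv₀, ← IsScalarTower.algebraMap_apply]
    exact eq_inv_of_mul_eq_one_right h
  rw [hx', isIntegral_algebraMap_iff (algebraMap (LaurentSeries k) Ω).injective,
    IsIntegrallyClosed.isIntegral_iff] at hx
  obtain ⟨b, hb⟩ := hx
  refine IsUnit.of_mul_eq_one b (IsFractionRing.injective (PowerSeries k) (LaurentSeries k) ?_)
  rw [map_mul, hb, mul_inv_cancel₀ ha, map_one]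

namespace TendsToZero

variable {y : AlgebraicClosure (LaurentSeries k)}

lemma isIntegral (hy : TendsToZero y) : IsIntegral (PowerSeries k) y := by
  obtain ⟨n, hn, z, hz, hyz⟩ := hy
  refine IsIntegral.of_pow hn ?_
  rw [hyz]
  exact isIntegral_algebraMap.mul hz

lemma mul_ne_algebraMap_of_isUnit (hy : TendsToZero y) {w : Ω}
    (hw : IsIntegral (PowerSeries k) w) {a : PowerSeries k} (ha : IsUnit a) :
    y * w ≠ algebraMap (PowerSeries k) Ω a := by
  obtain ⟨n, -, z, hz, hyz⟩ := hy
  intro h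
  obtain ⟨b, hb⟩ := (ha.pow n).exists_right_inv
  refine PowerSeries.X_prime.not_isUnit (isUnit_of_isIntegral_of_mul_eq_one
    (((hz.mul (hw.pow n)).mul (isIntegral_algebraMap (x := b)))) ?_)
  rw [← map_one (algebraMap (PowerSeries k) Ω), ← hb, map_mul, map_pow, ← h, mul_pow, hyz]
  ring

lemma of_isRoot {W : (PowerSeries k)[X]}
    (hW : W.IsDistinguishedAt (IsLocalRing.maximalIdeal (PowerSeries k)))
    (hy : (W.map (algebraMap (PowerSeries k) Ω)).IsRoot y) : TendsToZero y := by
  have hint : IsIntegral (PowerSeries k) y := ⟨W, hW.monic, by rwa [IsRoot, eval_map] at hy⟩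
  have hdvd : ∀ i < W.natDegree, PowerSeries.X ∣ W.coeff i := fun i hi => by
    rw [← Ideal.mem_span_singleton, ← PowerSeries.maximalIdeal_eq_span_X]
    exact hW.mem hi
  choose! w hw using hdvd
  rw [IsRoot, eval_map, eval₂_eq_sum_range, Finset.sum_range_succ, hW.monic.coeff_natDegree,
    map_one, one_mul] at hy
  have hpos : 0 < W.natDegree := by
    by_contra! h0
    rw [Nat.le_zero.1 h0, Finset.sum_range_zero, pow_zero, zero_add] at hy
    exact one_ne_zero hy
  have hsum : ∑ i ∈ Finset.range W.natDegree, algebraMap (PowerSeries k) Ω (W.coeff i) * y ^ i =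
      algebraMap (PowerSeries k) Ω PowerSeries.X *
        ∑ i ∈ Finset.range W.natDegree, algebraMap (PowerSeries k) Ω (w i) * y ^ i := by
    rw [Finset.mul_sum]
    refine Finset.sum_congr rfl fun i hi => ?_
    rw [hw i (Finset.mem_range.1 hi), map_mul, mul_assoc]
  rw [hsum] at hy
  refine ⟨W.natDegree, hpos,
    -∑ i ∈ Finset.range W.natDegree, algebraMap (PowerSeries k) Ω (w i) * y ^ i,
    (IsIntegral.sum _ fun i _ => isIntegral_algebraMap.mul (hint.pow i)).neg, ?_⟩
  linear_combination hy

lemma not_isRoot (hy : TendsToZero y) {H : (PowerSeries k)[X]} (hH : IsUnit (H.coeff 0)) :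
    ¬(H.map (algebraMap (PowerSeries k) Ω)).IsRoot y := by
  intro hroot
  refine hy.mul_ne_algebraMap_of_isUnit
    (w := -eval₂ (algebraMap (PowerSeries k) Ω) y H.divX) ?_ hH ?_
  · rw [eval₂_eq_sum_range]
    exact (IsIntegral.sum _ fun i _ => isIntegral_algebraMap.mul (hy.isIntegral.pow i)).neg
  · rw [IsRoot, eval_map, ← divX_mul_X_add H, eval₂_add, eval₂_mul, eval₂_X, eval₂_C] at hroot
    linear_combination -hroot

end TendsToZero

variable {W H : (PowerSeries k)[X]} {ι : Type*} [Fintype ι]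
  {a : AlgebraicClosure (LaurentSeries k)} {r : ι → AlgebraicClosure (LaurentSeries k)}

lemma setOf_isRoot_and_tendsToZero
    (hW : W.IsDistinguishedAt (IsLocalRing.maximalIdeal (PowerSeries k)))
    (hH : IsUnit (H.coeff 0)) (h : SplitsWithRoots (algebraMap (PowerSeries k) Ω) W a r) :
    {y | ((W * H).map (algebraMap (PowerSeries k) Ω)).IsRoot y ∧ TendsToZero y} =
      Set.range r := by
  ext y
  rw [Set.mem_ofPred_eq, Polynomial.map_mul, root_mul, ← h.isRoot_iff]
  exact ⟨fun ⟨hroot, hy⟩ => hroot.resolve_right (hy.not_isRoot hH),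
    fun hy => ⟨Or.inl hy, .of_isRoot hW hy⟩⟩

end SmallBranches

section DiagonalResidue

variable {k : Type*} [Field k]

/-- The coefficient of `y^m` of a series in `k((y))⟦t⟧`, as a series in `k⟦t⟧`. -/
def yCoeff (m : ℤ) : PowerSeries (LaurentSeries k) →+ PowerSeries k where
  toFun F := PowerSeries.mk fun n => (PowerSeries.coeff n F).coeff m
  map_zero' := by ext n; simp
  map_add' F G := by ext n; simp

variable (k) in
/-- The variable `y` of `k((y))⟦t⟧`. -/
def yVar : PowerSeries (LaurentSeries k) :=
  PowerSeries.C (HahnSeries.single 1 1)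

variable (k) in
/-- The embedding of `k⟦t⟧[y]` in `k((y))⟦t⟧`. -/
def polyToLaurent : (PowerSeries k)[X] →+* PowerSeries (LaurentSeries k) :=
  eval₂RingHom (PowerSeries.map HahnSeries.C) (yVar k)

variable (k) in
/-- The embedding of `k⟦y⟧⟦t⟧` in `k((y))⟦t⟧`. -/
def seriesToLaurent : PowerSeries (PowerSeries k) →+* PowerSeries (LaurentSeries k) :=
  PowerSeries.map (HahnSeries.ofPowerSeries ℤ k)

variable (k) in
/-- The embedding of `k⟦t⟧[y]` in `k⟦y⟧⟦t⟧`. -/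
def polyToSeries : (PowerSeries k)[X] →+* PowerSeries (PowerSeries k) :=
  eval₂RingHom (PowerSeries.map PowerSeries.C) (PowerSeries.C PowerSeries.X)

lemma coeff_yCoeff (m : ℤ) (F : PowerSeries (LaurentSeries k)) (n : ℕ) :
    PowerSeries.coeff n (yCoeff m F) = (PowerSeries.coeff n F).coeff m :=
  PowerSeries.coeff_mk n fun n => (PowerSeries.coeff n F).coeff m

lemma yCoeff_map_C_mul (m : ℤ) (a : PowerSeries k) (F : PowerSeries (LaurentSeries k)) :
    yCoeff m (PowerSeries.map HahnSeries.C a * F) = a * yCoeff m F := by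
  ext n
  simp only [coeff_yCoeff, PowerSeries.coeff_mul, HahnSeries.coeff_sum, PowerSeries.coeff_map,
    HahnSeries.C_mul_eq_smul, HahnSeries.coeff_smul, smul_eq_mul]

lemma yCoeff_yVar_pow_mul (m : ℤ) (l : ℕ) (F : PowerSeries (LaurentSeries k)) :
    yCoeff m (yVar k ^ l * F) = yCoeff (m - l) F := by
  ext n
  rw [coeff_yCoeff, coeff_yCoeff, yVar, ← map_pow, PowerSeries.coeff_C_mul, HahnSeries.single_pow,
    HahnSeries.coeff_single_mul, one_pow, one_mul, nsmul_one]

lemma yCoeff_polyToLaurent_mul (m : ℤ) (p : (PowerSeries k)[X])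
    (F : PowerSeries (LaurentSeries k)) :
    yCoeff m (polyToLaurent k p * F) =
      ∑ l ∈ Finset.range (p.natDegree + 1), p.coeff l * yCoeff (m - l) F := by
  rw [polyToLaurent, coe_eval₂RingHom, eval₂_eq_sum_range, Finset.sum_mul, map_sum]
  refine Finset.sum_congr rfl fun l _ => ?_
  rw [mul_assoc, yCoeff_map_C_mul, yCoeff_yVar_pow_mul]

lemma yCoeff_one_of_ne_zero {m : ℤ} (hm : m ≠ 0) :
    yCoeff m (1 : PowerSeries (LaurentSeries k)) = 0 := by
  ext n
  rw [coeff_yCoeff, PowerSeries.coeff_one]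
  split_ifs <;> simp [HahnSeries.coeff_one, hm]

lemma yCoeff_zero_one : yCoeff 0 (1 : PowerSeries (LaurentSeries k)) = 1 := by
  ext n
  rw [coeff_yCoeff, PowerSeries.coeff_one, PowerSeries.coeff_one]
  split_ifs <;> simp

section Inverse

variable {W : (PowerSeries k)[X]}
  (hW : W.IsDistinguishedAt (IsLocalRing.maximalIdeal (PowerSeries k)))
  {F : PowerSeries (LaurentSeries k)} (hF : polyToLaurent k W * F = 1)

include hW hF

lemma yCoeff_sub_natDegree_add_sum (m : ℤ) :
    yCoeff (m - W.natDegree) F +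
      ∑ l ∈ Finset.range W.natDegree, W.coeff l * yCoeff (m - l) F = yCoeff m 1 := by
  rw [← hF, yCoeff_polyToLaurent_mul, Finset.sum_range_succ, hW.monic.coeff_natDegree, one_mul,
    add_comm]

lemma yCoeff_eq_zero_of_neg_natDegree_lt {m : ℤ} (hm : -(W.natDegree : ℤ) < m) :
    yCoeff m F = 0 := by
  have hdvd (N : ℕ) : ∀ m : ℤ, -(W.natDegree : ℤ) < m → PowerSeries.X ^ N ∣ yCoeff m F := by
    induction N with
    | zero => exact fun m _ => by rw [pow_zero]; exact one_dvd _
    | succ N ih =>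
      intro m hm
      have hrec := yCoeff_sub_natDegree_add_sum hW hF (m + W.natDegree)
      rw [add_sub_cancel_right, yCoeff_one_of_ne_zero (by omega)] at hrec
      rw [eq_neg_of_add_eq_zero_left hrec, dvd_neg]
      refine Finset.dvd_sum fun l hl => ?_
      have hl := Finset.mem_range.1 hl
      have hX : PowerSeries.X ∣ W.coeff l := by
        rw [← Ideal.mem_span_singleton, ← PowerSeries.maximalIdeal_eq_span_X]
        exact hW.mem hl
      rw [pow_succ']
      exact mul_dvd_mul hX (ih _ (by omega))
  ext n
  rw [map_zero]
  exact PowerSeries.X_pow_dvd_iff.1 (hdvd (n + 1) m hm) n n.lt_succ_self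

lemma yCoeff_neg_natDegree : yCoeff (-(W.natDegree : ℤ)) F = 1 := by
  have hrec := yCoeff_sub_natDegree_add_sum hW hF 0
  rwa [zero_sub, yCoeff_zero_one, Finset.sum_eq_zero, add_zero] at hrec
  intro l hl
  have hl := Finset.mem_range.1 hl
  rw [yCoeff_eq_zero_of_neg_natDegree_lt hW hF (by omega), mul_zero]

lemma yCoeff_neg_one_polyToLaurent_mul {U : (PowerSeries k)[X]} (hU : U.degree < W.degree) :
    yCoeff (-1) (polyToLaurent k U * F) = U.coeff (W.natDegree - 1) := by
  rcases eq_or_ne U 0 with rfl | hU0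
  · rw [map_zero, zero_mul, map_zero, coeff_zero]
  have hdeg : U.natDegree < W.natDegree := natDegree_lt_natDegree hU0 hU
  rw [yCoeff_polyToLaurent_mul]
  by_cases hlast : U.natDegree = W.natDegree - 1
  · rw [← hlast, Finset.sum_range_succ, Finset.sum_eq_zero, zero_add,
      show (-1 : ℤ) - U.natDegree = -(W.natDegree : ℤ) by omega, yCoeff_neg_natDegree hW hF,
      mul_one]
    intro l hl
    have hl := Finset.mem_range.1 hl
    rw [yCoeff_eq_zero_of_neg_natDegree_lt hW hF (by omega), mul_zero]
  · rw [coeff_eq_zero_of_natDegree_lt (by omega)]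
    refine Finset.sum_eq_zero fun l hl => ?_
    have hl := Finset.mem_range.1 hl
    rw [yCoeff_eq_zero_of_neg_natDegree_lt hW hF (by omega), mul_zero]

end Inverse

lemma seriesToLaurent_polyToSeries (p : (PowerSeries k)[X]) :
    seriesToLaurent k (polyToSeries k p) = polyToLaurent k p := by
  have hcomp : (seriesToLaurent k).comp (polyToSeries k) = polyToLaurent k := by
    refine Polynomial.ringHom_ext' (RingHom.ext fun a => ?_) ?_
    · ext n
      simp [seriesToLaurent, polyToSeries, polyToLaurent]
    · simp [seriesToLaurent, polyToSeries, polyToLaurent, yVar]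
  exact RingHom.congr_fun hcomp p

lemma yCoeff_seriesToLaurent_of_neg {m : ℤ} (hm : m < 0) (F : PowerSeries (PowerSeries k)) :
    yCoeff m (seriesToLaurent k F) = 0 := by
  ext n
  rw [coeff_yCoeff, seriesToLaurent, PowerSeries.coeff_map, map_zero,
    HahnSeries.ofPowerSeries_apply]
  refine HahnSeries.embDomain_of_notMem_range ?_
  rintro ⟨x, hx⟩
  exact absurd (hx ▸ hm) (by simp)

lemma isUnit_polyToSeries {H : (PowerSeries k)[X]} (hH : IsUnit (H.coeff 0)) :
    IsUnit (polyToSeries k H) := by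
  have hconst : PowerSeries.constantCoeff (PowerSeries.constantCoeff (polyToSeries k H)) =
      PowerSeries.constantCoeff (H.coeff 0) := by
    nth_rw 1 [← H.divX_mul_X_add]
    rw [map_add, map_mul, polyToSeries, coe_eval₂RingHom, eval₂_X, eval₂_C, map_add, map_mul,
      PowerSeries.constantCoeff_C, map_add, map_mul, PowerSeries.constantCoeff_X, mul_zero,
      zero_add,
      ← PowerSeries.coeff_zero_eq_constantCoeff_apply (PowerSeries.map _ _), PowerSeries.coeff_map,
      PowerSeries.constantCoeff_C, PowerSeries.coeff_zero_eq_constantCoeff_apply]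
  rw [PowerSeries.isUnit_iff_constantCoeff, PowerSeries.isUnit_iff_constantCoeff, hconst]
  exact hH.map PowerSeries.constantCoeff

lemma isUnit_polyToLaurent_of_isDistinguishedAt {W : (PowerSeries k)[X]}
    (hW : W.IsDistinguishedAt (IsLocalRing.maximalIdeal (PowerSeries k))) :
    IsUnit (polyToLaurent k W) := by
  have hconst : PowerSeries.constantCoeff (polyToLaurent k W) =
      (HahnSeries.single 1 1 : LaurentSeries k) ^ W.natDegree := by
    rw [polyToLaurent, coe_eval₂RingHom, eval₂_eq_sum_range, map_sum, Finset.sum_range_succ,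
      Finset.sum_eq_zero, hW.monic.coeff_natDegree, map_one, one_mul, map_pow, yVar,
      PowerSeries.constantCoeff_C, zero_add]
    intro i hi
    have hX := hW.mem (Finset.mem_range.1 hi)
    rw [PowerSeries.maximalIdeal_eq_span_X, Ideal.mem_span_singleton] at hX
    obtain ⟨a, ha⟩ := hX
    rw [ha, map_mul, map_mul, map_mul, PowerSeries.map_X, PowerSeries.constantCoeff_X, zero_mul,
      zero_mul]
  rw [PowerSeries.isUnit_iff_constantCoeff, hconst, isUnit_iff_ne_zero]
  exact pow_ne_zero _ (HahnSeries.single_ne_zero one_ne_zero)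

lemma yCoeff_neg_one_of_mul_eq {W H U V : (PowerSeries k)[X]}
    (hW : W.IsDistinguishedAt (IsLocalRing.maximalIdeal (PowerSeries k)))
    (hH : IsUnit (H.coeff 0)) (hU : U.degree < W.degree) {F : PowerSeries (LaurentSeries k)}
    (hF : F * polyToLaurent k (W * H) = polyToLaurent k (U * H + W * V)) :
    yCoeff (-1) F = U.coeff (W.natDegree - 1) := by
  obtain ⟨H', hH'⟩ := (isUnit_polyToSeries hH).exists_right_inv
  obtain ⟨W', hW'⟩ := (isUnit_polyToLaurent_of_isDistinguishedAt hW).exists_right_inv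
  have hH'' := congrArg (seriesToLaurent k) hH'
  rw [map_mul, seriesToLaurent_polyToSeries, map_one] at hH''
  have hF' : F = polyToLaurent k U * W' + seriesToLaurent k (polyToSeries k V * H') := by
    rw [map_mul, map_add, map_mul, map_mul] at hF
    rw [map_mul, seriesToLaurent_polyToSeries]
    linear_combination (W' * seriesToLaurent k H') * hF +
      (polyToLaurent k U * W' - F * polyToLaurent k W * W') * hH'' +
      (polyToLaurent k V * seriesToLaurent k H' - F) * hW'
  rw [hF', map_add, yCoeff_seriesToLaurent_of_neg (by norm_num), add_zero,
    yCoeff_neg_one_polyToLaurent_mul hW hW' hU]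

/-- The small branches are the roots of the distinguished factor of `Q`. -/
theorem exists_smallBranches {P Q : (PowerSeries k)[X]} {c : ℕ}
    (hlow : ∀ i < c, ¬IsUnit (Q.coeff i)) (hc : IsUnit (Q.coeff c))
    (hsep : (Q.map (algebraMap (PowerSeries k) (AlgebraicClosure (LaurentSeries k)))).Separable) :
    ∃ (d : ℕ) (l : AlgebraicClosure (LaurentSeries k))
      (Y : Fin c ⊕ Fin d → AlgebraicClosure (LaurentSeries k)),
      SplitsWithRoots (algebraMap (PowerSeries k) _) Q l Y ∧ Function.Injective Y ∧
      {y | (Q.map (algebraMap (PowerSeries k) _)).IsRoot y ∧ TendsToZero y} =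
        Set.range (Y ∘ Sum.inl) ∧
      ∀ F, F * polyToLaurent k Q = polyToLaurent k P →
        ∑ i, simpleResidue (P.map (algebraMap (PowerSeries k) _))
          (Q.map (algebraMap (PowerSeries k) _)) (Y (Sum.inl i)) =
            algebraMap (PowerSeries k) _ (yCoeff (-1) F) := by
  obtain ⟨W, H, hW, rfl, hH, rfl⟩ := exists_isDistinguishedAt_mul hlow hc
  obtain ⟨U, V, hU, rfl⟩ :=
    exists_eq_mul_add_mul_of_isCoprime hW.monic (isCoprime_of_isDistinguishedAt hW hH) P
  have hH0 : H ≠ 0 := fun h => by simp [h] at hH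
  obtain ⟨r, hr⟩ := exists_splitsWithRoots_of_isAlgClosed
    (algebraMap_powerSeries_injective (k := k)) hW.monic.ne_zero
  obtain ⟨s, hs⟩ := exists_splitsWithRoots_of_isAlgClosed
    (algebraMap_powerSeries_injective (k := k)) hH0
  rw [(hW.monic.map _).leadingCoeff] at hr
  have hY := (hr.mul hs).injective_of_separable hsep
  refine ⟨H.natDegree, _, Sum.elim r s, hr.mul hs, hY, setOf_isRoot_and_tendsToZero hW hH hr,
    fun F hF => ?_⟩
  simp only [Sum.elim_inl]
  rw [hr.sum_simpleResidue_mul (hY.comp Sum.inl_injective)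
    (fun i => (TendsToZero.of_isRoot hW (hr.isRoot i)).not_isRoot hH),
    Fintype.card_fin, div_one, yCoeff_neg_one_of_mul_eq hW hH hU hF]
  rwa [Fintype.card_fin, ← degree_eq_natDegree hW.monic.ne_zero]

end DiagonalResidue

section Substitution

variable {k : Type*} [Field k]

variable (k) in
/-- The identification of power series in one variable, indexed by `Fin 1`, with `PowerSeries`. -/
def finOneToSeries : MvPowerSeries (Fin 1) k →+* PowerSeries k :=
  (MvPowerSeries.rename (R := k) (Equiv.ofUnique (Fin 1) Unit)).toRingHom

variable (k) in
/-- The substitution `f(x, y) ↦ f(t / y, y)` from `k⟦x, y⟧` to `k((y))⟦t⟧`: the variable `x` of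
`k⟦y⟧⟦x⟧` becomes `t`, rescaled by `1 / y`. -/
def diagSubst : MvPowerSeries (Fin 2) k →+* PowerSeries (LaurentSeries k) :=
  ((PowerSeries.rescale (HahnSeries.single (-1) 1 : LaurentSeries k)).comp (seriesToLaurent k)).comp
    ((PowerSeries.map (finOneToSeries k)).comp
      (MvPowerSeries.finSuccEquiv k 1).toAlgHom.toRingHom)

variable (k) in
/-- The inclusion of `k[t][y]` in `k⟦t⟧[y]`. -/
def toSeriesPoly : k[X][X] →+* (PowerSeries k)[X] :=
  mapRingHom coeToPowerSeries.ringHom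

lemma coeff_finOneToSeries (f : MvPowerSeries (Fin 1) k) (n : ℕ) :
    PowerSeries.coeff n (finOneToSeries k f) = MvPowerSeries.coeff (Finsupp.single 0 n) f := by
  have h := MvPowerSeries.coeff_embDomain_rename (R := k)
    (Equiv.ofUnique (Fin 1) Unit).toEmbedding f (Finsupp.single 0 n)
  rw [Finsupp.embDomain_single] at h
  exact h

lemma finOneToSeries_C (a : k) : finOneToSeries k (MvPowerSeries.C a) = PowerSeries.C a :=
  MvPowerSeries.rename_C _ a

lemma finOneToSeries_X : finOneToSeries k (MvPowerSeries.X 0) = PowerSeries.X :=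
  MvPowerSeries.rename_X _ 0

lemma rescale_C {R : Type*} [CommRing R] (a b : R) :
    PowerSeries.rescale a (PowerSeries.C b) = PowerSeries.C b := by
  ext n
  rw [PowerSeries.coeff_rescale, PowerSeries.coeff_C]
  split_ifs with h
  · rw [h, pow_zero, one_mul]
  · rw [mul_zero]

lemma diagSubst_apply (f : MvPowerSeries (Fin 2) k) : diagSubst k f =
    PowerSeries.rescale (HahnSeries.single (-1) 1 : LaurentSeries k)
      (seriesToLaurent k
        (PowerSeries.map (finOneToSeries k) (MvPowerSeries.finSuccEquiv k 1 f))) :=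
  rfl

lemma diagSubst_C (a : k) :
    diagSubst k (MvPowerSeries.C a) = PowerSeries.C (HahnSeries.C a) := by
  rw [diagSubst_apply, MvPowerSeries.finSuccEquiv_C, PowerSeries.map_C, finOneToSeries_C,
    seriesToLaurent, PowerSeries.map_C, HahnSeries.ofPowerSeries_C, rescale_C]

lemma diagSubst_X_one : diagSubst k (MvPowerSeries.X 1) = yVar k := by
  rw [diagSubst_apply, show (1 : Fin 2) = Fin.succ 0 from rfl, MvPowerSeries.finSuccEquiv_X_succ,
    PowerSeries.map_C, finOneToSeries_X, seriesToLaurent, PowerSeries.map_C,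
    HahnSeries.ofPowerSeries_X, rescale_C, yVar]

lemma C_single_neg_one_mul_yVar :
    PowerSeries.C (HahnSeries.single (-1) 1 : LaurentSeries k) * yVar k = 1 := by
  rw [yVar, ← map_mul, HahnSeries.single_mul_single, neg_add_cancel, one_mul,
    HahnSeries.single_zero_one, map_one]

lemma diagSubst_X_zero_mul_yVar : diagSubst k (MvPowerSeries.X 0) * yVar k = PowerSeries.X := by
  rw [diagSubst_apply, MvPowerSeries.finSuccEquiv_X_zero, PowerSeries.map_X, seriesToLaurent,
    PowerSeries.map_X, PowerSeries.rescale_X, mul_right_comm, C_single_neg_one_mul_yVar, one_mul]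

lemma yCoeff_zero_diagSubst (f : MvPowerSeries (Fin 2) k) : yCoeff 0 (diagSubst k f) = diag f := by
  ext n
  have hindex : Finsupp.cons n (Finsupp.single (0 : Fin 1) n) =
      Finsupp.single (0 : Fin 2) n + Finsupp.single 1 n := by
    ext i
    fin_cases i
    · simp
    · exact (Finsupp.cons_succ 0 n (Finsupp.single (0 : Fin 1) n)).trans (by simp)
  rw [coeff_yCoeff, diag, PowerSeries.coeff_mk, diagSubst_apply, PowerSeries.coeff_rescale,
    HahnSeries.single_pow, seriesToLaurent, PowerSeries.coeff_map, PowerSeries.coeff_map,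
    HahnSeries.coeff_single_mul, one_pow, one_mul,
    show (0 : ℤ) - n • (-1 : ℤ) = (n : ℕ) by simp, HahnSeries.ofPowerSeries_apply_coeff,
    coeff_finOneToSeries, MvPowerSeries.coeff_coeff_finSuccEquiv, hindex]

lemma polyToLaurent_toSeriesPoly_X : polyToLaurent k (toSeriesPoly k X) = yVar k := by
  simp [toSeriesPoly, polyToLaurent]

lemma diagSubst_mul_yVar_pow {A : MvPolynomial (Fin 2) k} {N : ℕ} (hN : A.degreeOf 0 ≤ N) :
    diagSubst k A * yVar k ^ N = polyToLaurent k (toSeriesPoly k (diagNumer N A)) := by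
  rw [← polyToLaurent_toSeriesPoly_X]
  refine map_mul_pow_eq_map_diagNumer
    (Θ := (diagSubst k).comp MvPolynomial.coeToMvPowerSeries.ringHom)
    (Ξ := (polyToLaurent k).comp (toSeriesPoly k)) (fun a => ?_) ?_ ?_ hN
  · simp [toSeriesPoly, polyToLaurent, diagSubst_C]
  · simp [diagSubst_X_zero_mul_yVar, toSeriesPoly, polyToLaurent]
  · simp [polyToLaurent_toSeriesPoly_X, diagSubst_X_one]

theorem exists_mul_polyToLaurent_eq_and_yCoeff_eq_ratDiag {A B : MvPolynomial (Fin 2) k} {N : ℕ}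
    (hB : B.coeff 0 ≠ 0) (hA : A.degreeOf 0 ≤ N) (hBN : B.degreeOf 0 ≤ N + 1) :
    ∃ F, F * polyToLaurent k (toSeriesPoly k (diagNumer (N + 1) B)) =
        polyToLaurent k (toSeriesPoly k (diagNumer N A)) ∧ yCoeff (-1) F = ratDiag A B := by
  have hy := C_single_neg_one_mul_yVar (k := k)
  have hinv : diagSubst k (B : MvPowerSeries (Fin 2) k)⁻¹ * diagSubst k B = 1 := by
    rw [← map_mul, MvPowerSeries.inv_mul_cancel, map_one]
    rwa [← MvPowerSeries.coeff_zero_eq_constantCoeff_apply, MvPolynomial.coeff_coe]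
  set y' := PowerSeries.C (HahnSeries.single (-1) 1 : LaurentSeries k)
  set f := (A : MvPowerSeries (Fin 2) k) * (B : MvPowerSeries (Fin 2) k)⁻¹ with hf
  refine ⟨y' * diagSubst k f, ?_, ?_⟩
  · rw [← diagSubst_mul_yVar_pow hA, ← diagSubst_mul_yVar_pow hBN, hf, map_mul, pow_succ]
    linear_combination (diagSubst k A * diagSubst k (B : MvPowerSeries (Fin 2) k)⁻¹ *
      diagSubst k B * yVar k ^ N) * hy + (diagSubst k A * yVar k ^ N) * hinv
  · have hshift := yCoeff_yVar_pow_mul 0 1 (y' * diagSubst k f)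
    rwa [pow_one, ← mul_assoc, mul_comm (yVar k), hy, one_mul, yCoeff_zero_diagSubst, Nat.cast_one,
      zero_sub, eq_comm] at hshift

end Substitution

section Embeddings

variable {k : Type*} [Field k]

lemma polyToBranches_injective : Function.Injective (polyToBranches k) :=
  algebraMap_powerSeries_injective.comp (Polynomial.coe_injective k)

variable (k) in
/-- The embedding of `k(t)` in the algebraic closure of `k((t))`. -/
def ratFuncToBranches : RatFunc k →+* AlgebraicClosure (LaurentSeries k) :=
  IsFractionRing.lift (A := k[X]) (polyToBranches_injective (k := k))

lemma map_overRatFunc (P : k[X][X]) :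
    (overRatFunc P).map (ratFuncToBranches k) = P.map (polyToBranches k) := by
  rw [overRatFunc, Polynomial.map_map]
  congr 1
  refine RingHom.ext fun a => ?_
  rw [RingHom.comp_apply, ratFuncToBranches, IsFractionRing.lift_algebraMap]

lemma map_toSeriesPoly (P : k[X][X]) :
    (toSeriesPoly k P).map (algebraMap (PowerSeries k) (AlgebraicClosure (LaurentSeries k))) =
      P.map (polyToBranches k) := by
  rw [toSeriesPoly, coe_mapRingHom, Polynomial.map_map, polyToBranches]

lemma isUnit_coeff_toSeriesPoly_iff {P : k[X][X]} {m : ℕ} :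
    IsUnit ((toSeriesPoly k P).coeff m) ↔ (P.coeff m).coeff 0 ≠ 0 := by
  rw [PowerSeries.isUnit_iff_constantCoeff, toSeriesPoly, coe_mapRingHom, coeff_map,
    coeToPowerSeries.ringHom_apply, Polynomial.constantCoeff_coe, isUnit_iff_ne_zero]

theorem exists_smallBranches_overRatFunc {P Q : k[X][X]} {c : ℕ}
    (hlow : ∀ m < c, (Q.coeff m).coeff 0 = 0) (hc : (Q.coeff c).coeff 0 ≠ 0)
    (hsep : (overRatFunc Q).Separable) :
    ∃ (d : ℕ) (l : AlgebraicClosure (LaurentSeries k))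
      (Y : Fin c ⊕ Fin d → AlgebraicClosure (LaurentSeries k)),
      SplitsWithRoots (ratFuncToBranches k) (overRatFunc Q) l Y ∧ Function.Injective Y ∧
      numSmallBranches Q = c ∧
      ∀ F, F * polyToLaurent k (toSeriesPoly k Q) = polyToLaurent k (toSeriesPoly k P) →
        ∑ i, simpleResidue ((overRatFunc P).map (ratFuncToBranches k))
          ((overRatFunc Q).map (ratFuncToBranches k)) (Y (Sum.inl i)) =
            algebraMap (PowerSeries k) _ (yCoeff (-1) F) := by
  obtain ⟨d, l, Y, hY, hinj, hsmall, hsum⟩ := exists_smallBranches (P := toSeriesPoly k P)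
    (fun m hm => by rw [isUnit_coeff_toSeriesPoly_iff, not_not, hlow m hm])
    (isUnit_coeff_toSeriesPoly_iff.2 hc)
    (by rw [map_toSeriesPoly, ← map_overRatFunc]; exact hsep.map)
  rw [map_toSeriesPoly, map_toSeriesPoly] at hsum
  rw [map_toSeriesPoly] at hsmall
  refine ⟨d, l, Y, ⟨hY.leadingCoeff_ne_zero, ?_⟩, hinj, ?_, fun F hF => ?_⟩
  · rw [map_overRatFunc, ← map_toSeriesPoly, hY.map_eq]
  · rw [numSmallBranches, hsmall, ← Set.image_univ,
      Set.ncard_image_of_injective _ (hinj.comp Sum.inl_injective), Set.ncard_univ, Nat.card_fin]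
  · rw [map_overRatFunc, map_overRatFunc]
    exact hsum F hF

end Embeddings

section Numerators

variable {k : Type*} [Field k] {Ψ : (RatFunc k)[X]} {Φ : k[X][X]}

lemma exists_isNumer (Ψ : (RatFunc k)[X]) : ∃ Φ, IsNumer Ψ Φ := by
  obtain ⟨b, hb, hbΨ⟩ := IsLocalization.integerNormalization_spec (nonZeroDivisors k[X]) Ψ
  set p := IsLocalization.integerNormalization (nonZeroDivisors k[X]) Ψ
  have hb0 : b ≠ 0 := nonZeroDivisors.ne_zero hb
  obtain ⟨e, Φ, g, hrel, he, hΦ⟩ :=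
    UniqueFactorizationMonoid.exists_reduced_factors (C b : k[X][X]) (C_ne_zero.2 hb0) p
  have hge0 : g ≠ 0 ∧ e ≠ 0 := mul_ne_zero_iff.1 (he ▸ C_ne_zero.2 hb0)
  have hdeg : g.natDegree + e.natDegree = 0 := by
    rw [← natDegree_mul hge0.1 hge0.2, he, natDegree_C]
  obtain ⟨e, rfl⟩ := natDegree_eq_zero.1 (Nat.add_eq_zero_iff.1 hdeg).2
  refine ⟨Φ, e, C_ne_zero.1 hge0.2, hrel.symm, mul_left_cancel₀ (overRatFunc_ne_zero hge0.1) ?_⟩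
  calc overRatFunc g * overRatFunc Φ = overRatFunc p := by
        rw [← hΦ, overRatFunc, overRatFunc, overRatFunc, Polynomial.map_mul]
    _ = C (algebraMap k[X] (RatFunc k) b) * Ψ := by
        rw [overRatFunc, hbΨ]
        ext i
        rw [coeff_smul, coeff_C_mul, Algebra.smul_def]
    _ = overRatFunc g * (C (algebraMap k[X] (RatFunc k) e) * Ψ) := by
        rw [← mul_assoc, overRatFunc, ← map_C, ← map_C, ← Polynomial.map_mul, he]

namespace IsNumer

lemma exists_overRatFunc_eq (h : IsNumer Ψ Φ) :
    ∃ e : RatFunc k, e ≠ 0 ∧ overRatFunc Φ = C e * Ψ := by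
  obtain ⟨e, he, -, h⟩ := h
  exact ⟨_, (map_ne_zero_iff _ (IsFractionRing.injective _ _)).2 he, h⟩

lemma irreducible (h : IsNumer Ψ Φ) (hΨ : Irreducible Ψ) : Irreducible (overRatFunc Φ) := by
  obtain ⟨e, he, h⟩ := h.exists_overRatFunc_eq
  rw [h]
  exact (irreducible_isUnit_mul (isUnit_C.2 he.isUnit)).2 hΨ

lemma natDegree_eq (h : IsNumer Ψ Φ) : (overRatFunc Φ).natDegree = Ψ.natDegree := by
  obtain ⟨e, he, h⟩ := h.exists_overRatFunc_eq
  rw [h, natDegree_C_mul he]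

lemma eval₂_eq_zero (h : IsNumer Ψ Φ) {f : PowerSeries k}
    (hf : (Ψ.map (ratFuncToBranches k)).IsRoot (algebraMap (PowerSeries k) _ f)) :
    eval₂ coeToPowerSeries.ringHom f Φ = 0 := by
  obtain ⟨e, -, he⟩ := h.exists_overRatFunc_eq
  refine algebraMap_powerSeries_injective (k := k) ?_
  rw [map_zero, hom_eval₂, ← polyToBranches, ← eval_map, ← map_overRatFunc, he,
    Polynomial.map_mul, eval_mul, hf.eq_zero, mul_zero]

end IsNumer

open scoped RatFunc in
lemma natDegree_seriesMinpoly {f : PowerSeries k} (hΦ : Irreducible (overRatFunc Φ))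
    (hf : eval₂ coeToPowerSeries.ringHom f Φ = 0) :
    (seriesMinpoly f).natDegree = (overRatFunc Φ).natDegree := by
  have hcomp : (algebraMap (RatFunc k) (LaurentSeries k)).comp (algebraMap k[X] (RatFunc k)) =
      (algebraMap (PowerSeries k) (LaurentSeries k)).comp coeToPowerSeries.ringHom := by
    refine RingHom.ext fun a => ?_
    rw [RingHom.comp_apply, RingHom.comp_apply, ← IsScalarTower.algebraMap_apply]
    rfl
  have hroot : aeval (algebraMap (PowerSeries k) (LaurentSeries k) f) (overRatFunc Φ) = 0 := by
    rw [aeval_def, overRatFunc, eval₂_map, hcomp, ← hom_eval₂, hf, map_zero]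
  rw [seriesMinpoly, ← minpoly.eq_of_irreducible hΦ hroot, natDegree_mul_C]
  exact inv_ne_zero (leadingCoeff_ne_zero.2 hΦ.ne_zero)

end Numerators

section Correctness

variable {k : Type*} [Field k] [CharZero k]

theorem numSmallBranches_eq_and_isRoot_pureComposedSum {P Q : k[X][X]} {c : ℕ} {R : (RatFunc k)[X]}
    {F : PowerSeries (LaurentSeries k)} (hQ : Irreducible (overRatFunc Q))
    (hlow : ∀ m < c, (Q.coeff m).coeff 0 = 0) (hQc : (Q.coeff c).coeff 0 ≠ 0)
    (hF : F * polyToLaurent k (toSeriesPoly k Q) = polyToLaurent k (toSeriesPoly k P))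
    (hR : IsAlgebraicResidues (overRatFunc P) (overRatFunc Q) R)
    (hdeg : (pureComposedSum R c).natDegree = (overRatFunc Q).natDegree.choose c) :
    numSmallBranches Q = c ∧ ((pureComposedSum R c).map (ratFuncToBranches k)).IsRoot
      (algebraMap (PowerSeries k) _ (yCoeff (-1) F)) := by
  obtain ⟨d, l, Y, hY, hinj, hsmall, hsum⟩ :=
    exists_smallBranches_overRatFunc hlow hQc hQ.separable
  have : Nonempty (Fin c ⊕ Fin d) := Fintype.card_pos_iff.1 (hY.natDegree_eq ▸ hQ.natDegree_pos)
  have : CharZero (AlgebraicClosure (LaurentSeries k)) :=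
    ((ratFuncToBranches k).charZero_iff (ratFuncToBranches k).injective).1 inferInstance
  obtain ⟨u, hu⟩ := hR.exists_splitsWithRoots hY hinj hQ.squarefree
  refine ⟨hsmall, ?_⟩
  rw [hu.map_pureComposedSum_of_natDegree (by rw [hdeg, hY.natDegree_eq]), IsRoot, eval_prod]
  refine Finset.prod_eq_zero (i := Finset.univ.map Function.Embedding.inl) ?_ ?_
  · rw [Finset.mem_powersetCard, Finset.card_map, Finset.card_univ, Fintype.card_fin]
    exact ⟨Finset.subset_univ _, rfl⟩
  · rw [Finset.sum_map, eval_sub, eval_X, eval_C, ← hsum F hF]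
    exact sub_self _

variable {E ι : Type*} [Field E] [Fintype ι] {θ : RatFunc k →+* E} {l : E} {Y : ι → E}
  {A B : MvPolynomial (Fin 2) k} {N M : ℕ} (hB : IsRegularDenominator (N + 1) (M + 1) B)
  (hA : A ≠ 0) (hN : A.degreeOf 0 ≤ N) (hM : A.degreeOf 1 ≤ M)

include hB hA hN hM

theorem IsRegularDenominator.exists_isAlgebraicDiagonal
    (hQ : Irreducible (overRatFunc (diagNumer (N + 1) B))) : ∃ Φ, IsAlgebraicDiagonal A B Φ := by
  obtain ⟨R, hR⟩ := exists_isAlgebraicResidues (overRatFunc (diagNumer N A)) hQ.squarefree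
    hQ.natDegree_pos
  obtain ⟨Φ, hΦ⟩ := exists_isNumer (pureComposedSum R (numSmallBranches (diagNumer (N + 1) B)))
  exact ⟨Φ, _, _, R, hB.isReducedForm hQ hA hN hM, hR, hΦ⟩

theorem HasSymmetricRoots.irreducible_and_eval₂_ratDiag_eq_zero
    (hsymm : HasSymmetricRoots θ (overRatFunc (diagNumer (N + 1) B)) l Y) {Φ : k[X][X]}
    (h : IsAlgebraicDiagonal A B Φ) :
    Irreducible (overRatFunc Φ) ∧
      (overRatFunc Φ).natDegree = (N + 1 + (M + 1)).choose (N + 1) ∧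
      eval₂ coeToPowerSeries.ringHom (ratDiag A B) Φ = 0 := by
  have hcard : Fintype.card ι = N + 1 + (M + 1) := by
    rw [← hsymm.natDegree_eq, natDegree_overRatFunc, hB.natDegree_diagNumer]
  have : Nonempty ι := Fintype.card_pos_iff.1 (by omega)
  have : CharZero E := (θ.charZero_iff θ.injective).1 inferInstance
  obtain ⟨P, Q, R, hPQ, hR, hΦ⟩ := h
  obtain ⟨a, ha, rfl, rfl⟩ :=
    (hB.isReducedForm hsymm.irreducible hA hN hM).exists_eq_C_mul hPQ
  have hsymm' := hsymm.C_mul ((map_ne_zero (algebraMap k (RatFunc k))).2 ha)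
  rw [← overRatFunc_C_C_mul] at hsymm'
  have hP : overRatFunc (C (C a) * diagNumer N A) ≠ 0 := overRatFunc_ne_zero <|
    mul_ne_zero (C_ne_zero.2 (C_ne_zero.2 ha)) (diagNumer_ne_zero hA hN)
  have hPdeg : (overRatFunc (C (C a) * diagNumer N A)).natDegree + 2 ≤ Fintype.card ι := by
    rw [natDegree_overRatFunc, natDegree_C_mul (C_ne_zero.2 ha), hcard]
    have := natDegree_diagNumer_le (N := N) hM
    omega
  obtain ⟨F, hF, hdiag⟩ := exists_mul_polyToLaurent_eq_and_yCoeff_eq_ratDiag (A := A)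
    hB.coeff_zero_ne_zero hN hB.degreeOf_zero_le
  obtain ⟨hirr, hdeg⟩ :=
    hsymm'.irreducible_pureComposedSum hP hPdeg hR N.succ_pos (by omega)
  obtain ⟨hsmall, hroot⟩ := numSmallBranches_eq_and_isRoot_pureComposedSum (F := F)
    hsymm'.irreducible
    (fun m hm => by rw [coeff_C_mul, coeff_C_mul, hB.coeff_coeff_zero_of_lt hm, mul_zero])
    (by
      rw [coeff_C_mul, coeff_C_mul]
      exact mul_ne_zero ha hB.coeff_coeff_zero_ne_zero)
    (by rw [map_mul, map_mul, map_mul, map_mul, ← hF, mul_left_comm]) hR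
    (by rw [hdeg, hsymm'.natDegree_eq])
  rw [hsmall] at hΦ
  exact ⟨hΦ.irreducible hirr, by rw [hΦ.natDegree_eq, hdeg, hcard],
    hdiag ▸ hΦ.eval₂_eq_zero hroot⟩

end Correctness

lemma extendA_ne_zero {dx dy : ℕ} {A : MvPolynomial (Fin 2) ℚ} (hA : A ≠ 0) :
    extendA dx dy A ≠ 0 :=
  (map_ne_zero_iff _ (MvPolynomial.map_injective _ (algebraMap ℚ _).injective)).2 hA

lemma degreeOf_extendA {dx dy : ℕ} (A : MvPolynomial (Fin 2) ℚ) (i : Fin 2) :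
    (extendA dx dy A).degreeOf i = A.degreeOf i := by
  classical
  rw [extendA, MvPolynomial.degreeOf_def, MvPolynomial.degreeOf_def,
    MvPolynomial.degrees_map_of_injective _ (algebraMap ℚ _).injective]

lemma two_pow_le_centralBinom (n : ℕ) : 2 ^ n ≤ n.centralBinom := by
  induction n with
  | zero => rfl
  | succ n ih =>
    refine Nat.le_of_mul_le_mul_left (?_ : (n + 1) * _ ≤ (n + 1) * _) n.succ_pos
    rw [Nat.succ_mul_centralBinom_succ, pow_succ]
    nlinarith [Nat.zero_le (n * n.centralBinom)]

lemma two_pow_min_le_choose (m n : ℕ) : 2 ^ min m n ≤ (m + n).choose m := by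
  wlog h : m ≤ n generalizing m n
  · rw [min_comm, Nat.choose_symm_add, add_comm]
    exact this n m (by omega)
  calc 2 ^ min m n ≤ m.centralBinom := by
        rw [min_eq_left h]
        exact two_pow_le_centralBinom m
    _ ≤ (m + n).choose m := Nat.choose_le_choose m (by omega)

end AlgDiag

end

theorem mainTheorem2_general (dx dy : ℕ) (A : MvPolynomial (Fin 2) (AlgDiag.GenericField dx dy))
    (hA : A ≠ 0) (hAx : A.degreeOf 0 < dx) (hAy : A.degreeOf 1 < dy) :
    (∃ Φ, AlgDiag.IsAlgebraicDiagonal A (AlgDiag.genericB dx dy) Φ) ∧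
    (∀ Φ, AlgDiag.IsAlgebraicDiagonal A (AlgDiag.genericB dx dy) Φ →
      Irreducible (AlgDiag.overRatFunc Φ) ∧
      (AlgDiag.overRatFunc Φ).natDegree = (dx + dy).choose dx ∧
      Polynomial.eval₂ Polynomial.coeToPowerSeries.ringHom
        (AlgDiag.ratDiag A (AlgDiag.genericB dx dy)) Φ = 0) ∧
    (AlgDiag.seriesMinpoly (AlgDiag.ratDiag A (AlgDiag.genericB dx dy))).natDegree =
      (dx + dy).choose dx ∧
    2 ^ min dx dy ≤
      (AlgDiag.seriesMinpoly (AlgDiag.ratDiag A (AlgDiag.genericB dx dy))).natDegree := by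
  obtain ⟨N, rfl⟩ := Nat.exists_eq_add_one_of_ne_zero hAx.ne_bot
  obtain ⟨M, rfl⟩ := Nat.exists_eq_add_one_of_ne_zero hAy.ne_bot
  rw [Nat.lt_succ_iff] at hAx hAy
  have hB := AlgDiag.isRegularDenominator_genericB (N + 1) (M + 1)
  obtain ⟨θ, l, Y, hsymm⟩ := AlgDiag.exists_hasSymmetricRoots_genericB (N + 1) (M + 1)
  obtain ⟨Φ, hΦ⟩ := hB.exists_isAlgebraicDiagonal hA hAx hAy hsymm.irreducible
  have hcorrect := fun Ψ => hsymm.irreducible_and_eval₂_ratDiag_eq_zero hB hA hAx hAy (Φ := Ψ)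
  obtain ⟨hirr, hdeg, hroot⟩ := hcorrect Φ hΦ
  have hminpoly := (AlgDiag.natDegree_seriesMinpoly hirr hroot).trans hdeg
  exact ⟨⟨Φ, hΦ⟩, hcorrect, hminpoly, hminpoly ▸ AlgDiag.two_pow_min_le_choose _ _⟩

theorem mainTheorem2 (dx dy : ℕ) (A : MvPolynomial (Fin 2) ℚ) (hA : A ≠ 0)
    (hAx : A.degreeOf 0 < dx) (hAy : A.degreeOf 1 < dy) :
    (∃ Φ, AlgDiag.IsAlgebraicDiagonal (AlgDiag.extendA dx dy A) (AlgDiag.genericB dx dy) Φ) ∧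
    (∀ Φ, AlgDiag.IsAlgebraicDiagonal (AlgDiag.extendA dx dy A) (AlgDiag.genericB dx dy) Φ →
      Irreducible (AlgDiag.overRatFunc Φ) ∧
      (AlgDiag.overRatFunc Φ).natDegree = (dx + dy).choose dx ∧
      Polynomial.eval₂ Polynomial.coeToPowerSeries.ringHom
        (AlgDiag.ratDiag (AlgDiag.extendA dx dy A) (AlgDiag.genericB dx dy)) Φ = 0) ∧
    (AlgDiag.seriesMinpoly
      (AlgDiag.ratDiag (AlgDiag.extendA dx dy A) (AlgDiag.genericB dx dy))).natDegree =
        (dx + dy).choose dx ∧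
    2 ^ min dx dy ≤ (AlgDiag.seriesMinpoly
      (AlgDiag.ratDiag (AlgDiag.extendA dx dy A) (AlgDiag.genericB dx dy))).natDegree :=
  mainTheorem2_general dx dy _ (AlgDiag.extendA_ne_zero hA)
    (by rwa [AlgDiag.degreeOf_extendA]) (by rwa [AlgDiag.degreeOf_extendA])
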